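/- Let $\beta>1$ be real, put $l=-\frac{\beta}{\beta+1}$, and for $x\in[l,l+1)$ let $T(x)=-\beta x-\lfloor-\beta x-l\rfloor$ and $d_{-\beta}(x)=x_{-1}x_{-2}x_{-3}\cdots$ with $x_{-i}=\lfloor-\beta T^{i-1}(x)-l\rfloor$. Call $\beta$ an Ito--Sadahiro number if the string $d_{-\beta}(l)$ is eventually periodic. Let $\mathbb{Z}_{-\beta}$ be the set of real numbers $x$ such that for some integer $k\ge 0$ we have $x/(-\beta)^k\in(l,l+1)$ and all the digits of $d_{-\beta}(x/(-\beta)^k)$ after the first $k$ are $0$. A bidirectional word $u=(u_j)_{j\in\mathbb{Z}}$ codes $\mathbb{Z}_{-\beta}$ if $\mathbb{Z}_{-\beta}=\{t_j\mid j\in\mathbb{Z}\}$ with $t_0=0$ and $t_j<t_{j+1}$ for all $j$, and there are pairwise distinct real numbers $\Delta_X$, one for each letter $X$, such that $t_{j+1}-t_j=\Delta_{u_j}$ for all $j$; if such a word exists, it is unique up to renaming the letters and is denoted $u_{-\beta}$. A bidirectional word is Sturmian if exactly two letters occur in it, it is eventually periodic neither to the right nor to the left, and it is balanced, i.e. for any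 two of its factors of equal length and any letter $a$, the numbers of occurrences of $a$ in the two factors differ by at most $1$. A Pisot number is a real root greater than $1$ of a monic irreducible polynomial with integer coefficients whose other complex roots all have modulus less than $1$; it is a quadratic Pisot unit if it has degree $2$ and $\beta^{-1}$ is an algebraic integer as well. **Corollary.** Let $\beta>1$ be an Ito--Sadahiro number. If $\beta$ is a quadratic Pisot unit, then there is a bidirectional word $u_{-\beta}$ over a two-letter alphabet that codes $\mathbb{Z}_{-\beta}$. Moreover, whenever a bidirectional word $u_{-\beta}$ codes $\mathbb{Z}_{-\beta}$, it is Sturmian if and only if $\beta$ is a quadratic Pisot unit. -/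

import Mathlib

open Polynomial

noncomputable section

namespace NegBeta

/-! ### The Ito-Sadahiro numeration system with base `-β` -/

/-- The left end-point `l = -β/(β+1)` of the interval `I = [l, l+1)`. -/
def leftEnd (β : ℝ) : ℝ := -β / (β + 1)

/-- The transformation `T(x) = -βx - ⌊-βx - l⌋`. -/
def T (β x : ℝ) : ℝ := -β * x - (⌊-β * x - leftEnd β⌋ : ℝ)

/-- The digits of `d_{-β}(x)`, indexed from `0`: `digit β x i` is `⌊-β T^i(x) - l⌋`, that is,
the digit `x_{-(i+1)}`. -/
def digit (β x : ℝ) (i : ℕ) : ℤ := ⌊-β * ((T β)^[i] x) - leftEnd β⌋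

/-- `β` is an Ito-Sadahiro number: `β > 1` and the digit string `d_{-β}(l)` is eventually
periodic. -/
def IsItoSadahiro (β : ℝ) : Prop :=
  1 < β ∧ ∃ N p : ℕ, 0 < p ∧
    ∀ i, N ≤ i → digit β (leftEnd β) (i + p) = digit β (leftEnd β) i

/-- The set `ℤ_{-β}` of `(-β)`-integers: for a suitable power `k`, the number `x / (-β)^k` lies in
the open interval `(l, l+1)` and its digits after the first `k` ones all vanish, so that
the `(-β)`-expansion of `x` is `x_{k-1} ⋯ x_1 x_0 • 0^ω`.
(Replacing `k` by `k + 1` only adds a leading zero.) -/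
def negBetaIntegers (β : ℝ) : Set ℝ :=
  {x | ∃ k : ℕ, x / (-β) ^ k ∈ Set.Ioo (leftEnd β) (leftEnd β + 1) ∧
    ∀ i, k ≤ i → digit β (x / (-β) ^ k) i = 0}

/-- The pointed bidirectional word `u` over the alphabet `A` codes `ℤ_{-β}`:
`ℤ_{-β} = {t_j | j ∈ ℤ}` with `t_j < t_{j+1}` and `t_0 = 0`, distinct letters `X` stand for
distinct distances `Δ_X`, and `u_j = X` when `t_{j+1} - t_j = Δ_X`. -/
def IsCodingWord (β : ℝ) {A : Type*} (u : ℤ → A) : Prop :=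
  ∃ (t : ℤ → ℝ) (Δ : A → ℝ),
    StrictMono t ∧ t 0 = 0 ∧ Set.range t = negBetaIntegers β ∧
    Function.Injective Δ ∧ ∀ j, t (j + 1) - t j = Δ (u j)

/-! ### Bidirectional Sturmian words -/

/-- The finite word `w` is a factor of the bidirectional word `u`. -/
def IsFactor {A : Type*} (w : List A) (u : ℤ → A) : Prop :=
  ∃ i : ℤ, w = (List.range w.length).map fun j : ℕ => u (i + j)

open Classical in
/-- Balanced: the numbers of occurrences of any letter in any two factors of the same length
differ by at most one. -/
def IsBalanced {A : Type*} (u : ℤ → A) : Prop :=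
  ∀ w v : List A, IsFactor w u → IsFactor v u → w.length = v.length →
    ∀ a : A, |(w.count a : ℤ) - (v.count a : ℤ)| ≤ 1

/-- Aperiodic: eventually periodic neither to the right nor to the left. -/
def IsAperiodic {A : Type*} (u : ℤ → A) : Prop :=
  (¬ ∃ (N p : ℤ), 0 < p ∧ ∀ i, N ≤ i → u (i + p) = u i) ∧
  (¬ ∃ (N p : ℤ), 0 < p ∧ ∀ i, i ≤ N → u (i - p) = u i)

/-- A bidirectional Sturmian word: a binary (exactly two letters occur), aperiodic, balanced
word. -/
def IsSturmian {A : Type*} (u : ℤ → A) : Prop :=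
  (Set.range u).ncard = 2 ∧ IsAperiodic u ∧ IsBalanced u

/-! ### Quadratic Pisot units -/

/-- A Pisot number: a real root `β > 1` of a monic irreducible integer polynomial all of whose
other complex roots have modulus less than one. -/
def IsPisot (β : ℝ) : Prop :=
  1 < β ∧ ∃ p : ℤ[X], p.Monic ∧ Irreducible p ∧ aeval β p = 0 ∧
    ∀ z : ℂ, aeval z p = 0 → z ≠ (β : ℂ) → ‖z‖ < 1

/-- A quadratic Pisot unit: a Pisot number of degree two such that both `β` and `β⁻¹` are
algebraic integers. -/
def IsQuadraticPisotUnit (β : ℝ) : Prop :=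
  IsPisot β ∧ (minpoly ℚ β).natDegree = 2 ∧ IsIntegral ℤ β ∧ IsIntegral ℤ β⁻¹

end NegBeta

end

/-! ### The transformation `T` on `[l, l+1)` -/

noncomputable section

namespace NegBeta

variable {β : ℝ}

/-! Let `β² = Aβ + B` with conjugate `β' = A - β`.

Sufficiency. If `B = ±1`, appending a digit `d` sends the conjugate `s` of the integer part to `d -
β's`. As `|β'| = 1/β`, this is a contraction, and the pair (residue, `s`) stays in an explicit
region (`UnitInvNeg`, `UnitInvPos`). Slicing that region at residue `0` shows that `ℤ_{-β}` consists
of all `a + cβ` whose conjugate lies in a half-open window `[w, w + κ)`, where `κ = r + 1 - β'` for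
an integer `r` (`negBetaIntegers_eq_of_window`). Such a set is enumerated by `j + ⌊(j - w)/κ⌋ (β - r
- 1)` (`exists_beatty_enumeration`), so its gaps `1` and `β - r` alternate as in a Beatty sequence
with irrational slope, which is Sturmian (`isSturmian_of_beatty`).

Necessity. With `r = ⌊β²/(β+1)⌋`, the gaps on the two sides of `0` are `1` and `β - r`
(`gaps_at_zero`). An integer `β` gives a single gap; otherwise these are the only two gaps of a
Sturmian coding, so `ℤ_{-β} ⊆ ℤ + ℤβ`. Since `β² ∈ ℤ_{-β}`, `β` is quadratic. Balance gives the
coding a slope with deviation at most `1`, and stability of `ℤ_{-β}` under `-β` forces that slope to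
be `1/κ`; hence conjugates of points differ by at most `|κ|` (`conjugate_bound`). This yields `|β'|
< 1`, and explicit points whose conjugates would be too far apart rule out `|B| ≥ 2`
(`int_unit_of_conjugate_pos`, `int_unit_of_conjugate_neg`). -/

lemma leftEnd_mul (h : 1 < β) : leftEnd β * (β + 1) = -β := by
  unfold leftEnd; field_simp

lemma leftEnd_neg (h : 1 < β) : leftEnd β < 0 := by
  have := leftEnd_mul h
  nlinarith

lemma neg_one_lt_leftEnd (h : 1 < β) : -1 < leftEnd β := by
  have := leftEnd_mul h
  nlinarith

lemma mul_leftEnd (h : 1 < β) : β * leftEnd β = -β - leftEnd β := by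
  linarith [leftEnd_mul h]

/-- `T` maps `y` to the unique element of `[l, l+1)` congruent to `-βy` modulo `1`. -/
lemma T_eq {y z : ℝ} (d : ℤ) (hz : z ∈ Set.Ico (leftEnd β) (leftEnd β + 1))
    (h : z = -β * y - d) : T β y = z := by
  have : ⌊-β * y - leftEnd β⌋ = d := by
    rw [Int.floor_eq_iff]
    constructor <;> linarith [hz.1, hz.2]
  rw [T, this, h]

lemma T_mem (y : ℝ) : T β y ∈ Set.Ico (leftEnd β) (leftEnd β + 1) := by
  unfold T
  constructor <;>
  linarith [Int.floor_le (-β * y - leftEnd β), Int.lt_floor_add_one (-β * y - leftEnd β)]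

lemma zero_mem_Ioo (h : 1 < β) : (0 : ℝ) ∈ Set.Ioo (leftEnd β) (leftEnd β + 1) :=
  ⟨leftEnd_neg h, by linarith [neg_one_lt_leftEnd h]⟩

lemma T_zero (h : 1 < β) : T β 0 = 0 :=
  T_eq 0 (Set.Ioo_subset_Ico_self (zero_mem_Ioo h)) (by simp)

lemma iterate_T_mem {y : ℝ} (hy : y ∈ Set.Ico (leftEnd β) (leftEnd β + 1)) (k : ℕ) :
    (T β)^[k] y ∈ Set.Ico (leftEnd β) (leftEnd β + 1) := by
  cases k with
  | zero => exact hy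
  | succ k => rw [Function.iterate_succ_apply']; exact T_mem _

lemma iterate_T_succ (y : ℝ) (i : ℕ) :
    (T β)^[i + 1] y = -β * (T β)^[i] y - digit β y i := by
  rw [Function.iterate_succ_apply', T, digit]

/-! ### Fractional parts in base `-β` -/

/-- `Residue β x y` says that `y` is the fractional part of `x` in base `-β`. -/
def Residue (β x y : ℝ) : Prop :=
  ∃ k : ℕ, x / (-β) ^ k ∈ Set.Ioo (leftEnd β) (leftEnd β + 1) ∧ (T β)^[k] (x / (-β) ^ k) = y

lemma eq_zero_of_pow_mul_bounded (h : 1 < β) {z : ℝ}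
    (hz : ∀ n : ℕ, |(-β) ^ n * z| ≤ 1) : z = 0 := by
  by_contra hne
  have hpos : 0 < |z| := abs_pos.mpr hne
  obtain ⟨n, hn⟩ := pow_unbounded_of_one_lt (1 / |z|) h
  have h1 := hz n
  rw [abs_mul, abs_pow, abs_neg, abs_of_pos (by linarith : 0 < β)] at h1
  rw [div_lt_iff₀ hpos] at hn
  linarith

/-- While digits vanish, `T` is multiplication by `-β`; a bounded orbit of this kind must be `0`. -/
lemma mem_negBetaIntegers_iff (h : 1 < β) {x : ℝ} :
    x ∈ negBetaIntegers β ↔ Residue β x 0 := by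
  constructor
  · rintro ⟨k, hk, hd⟩
    refine ⟨k, hk, ?_⟩
    set y := x / (-β) ^ k with hy
    apply eq_zero_of_pow_mul_bounded h
    intro n
    have key : (T β)^[k + n] y = (-β) ^ n * (T β)^[k] y := by
      induction n with
      | zero => simp
      | succ n ih =>
        rw [← add_assoc, iterate_T_succ, hd _ (by omega), ih]
        push_cast; ring
    rw [← key, abs_le]
    have := iterate_T_mem (Set.Ioo_subset_Ico_self hk) (k + n)
    constructor <;> linarith [this.1, this.2, leftEnd_neg h, neg_one_lt_leftEnd h]
  · rintro ⟨k, hk, hT⟩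
    refine ⟨k, hk, fun i hi => ?_⟩
    set y := x / (-β) ^ k with hy
    have key : (T β)^[i] y = 0 := by
      obtain ⟨n, rfl⟩ := Nat.exists_eq_add_of_le hi
      clear hi
      induction n with
      | zero => simpa using hT
      | succ n ih => rw [← add_assoc, Function.iterate_succ_apply', ih, T_zero h]
    rw [digit, key, Int.floor_eq_iff]
    constructor <;> push_cast <;> linarith [leftEnd_neg h, neg_one_lt_leftEnd h]

lemma Residue.refl {x : ℝ} (hx : x ∈ Set.Ioo (leftEnd β) (leftEnd β + 1)) : Residue β x x :=
  ⟨0, by simpa using hx, by simp⟩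

lemma Residue.map_T (h : 1 < β) {x y : ℝ} (hxy : Residue β x y) :
    Residue β (-β * x) (T β y) := by
  obtain ⟨k, hk, rfl⟩ := hxy
  have e : -β * x / (-β) ^ (k + 1) = x / (-β) ^ k := by
    have : -β ≠ 0 := by linarith
    rw [pow_succ']; field_simp
  refine ⟨k + 1, by rwa [e], ?_⟩
  rw [e, Function.iterate_succ_apply']

lemma Residue.step (h : 1 < β) {x y x' z : ℝ} (hxy : Residue β x y) (d : ℤ)
    (hz : z ∈ Set.Ico (leftEnd β) (leftEnd β + 1)) (hx' : x' = -β * x)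
    (hzy : z = -β * y - d) : Residue β x' z := by
  rw [hx', ← T_eq d hz hzy]
  exact hxy.map_T h

lemma T_div_neg (h : 1 < β) {y : ℝ} (hy : y ∈ Set.Ico (leftEnd β) (leftEnd β + 1)) :
    T β (y / -β) = y := by
  apply T_eq 0 hy
  have : β ≠ 0 := by linarith
  push_cast; field_simp; ring

lemma div_neg_mem_Ioo (h : 1 < β) {y : ℝ} (hy : y ∈ Set.Ioo (leftEnd β) (leftEnd β + 1)) :
    y / -β ∈ Set.Ioo (leftEnd β) (leftEnd β + 1) := by
  have hl := mul_leftEnd h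
  have := leftEnd_neg h
  have := neg_one_lt_leftEnd h
  obtain ⟨h1, h2⟩ := hy
  rw [div_neg, ← neg_div]
  constructor
  · rw [lt_div_iff₀ (by linarith)]; nlinarith
  · rw [div_lt_iff₀ (by linarith)]; nlinarith

/-- Dividing by `-β` stays in the open interval and is undone by `T`, so the power `k` is
immaterial. The interval has to be open: `l / (-β) = l + 1`. -/
lemma Residue.aux (h : 1 < β) {x : ℝ} {k : ℕ} (n : ℕ)
    (hk : x / (-β) ^ k ∈ Set.Ioo (leftEnd β) (leftEnd β + 1)) :
    x / (-β) ^ (k + n) ∈ Set.Ioo (leftEnd β) (leftEnd β + 1) ∧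
      (T β)^[k + n] (x / (-β) ^ (k + n)) = (T β)^[k] (x / (-β) ^ k) := by
  induction n with
  | zero => exact ⟨hk, rfl⟩
  | succ n ih =>
    have e : x / (-β) ^ (k + (n + 1)) = x / (-β) ^ (k + n) / -β := by
      rw [← add_assoc, pow_succ, div_div]
    rw [e]
    refine ⟨div_neg_mem_Ioo h ih.1, ?_⟩
    rw [← add_assoc, Function.iterate_succ_apply, T_div_neg h (Set.Ioo_subset_Ico_self ih.1), ih.2]

lemma Residue.unique (h : 1 < β) {x y z : ℝ} (hy : Residue β x y) (hz : Residue β x z) :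
    y = z := by
  obtain ⟨k, hk, rfl⟩ := hy
  obtain ⟨n, hn, rfl⟩ := hz
  rw [← (Residue.aux h n hk).2, ← (Residue.aux h k hn).2, add_comm]

lemma Residue.mem {x y : ℝ} (hy : Residue β x y) :
    y ∈ Set.Ico (leftEnd β) (leftEnd β + 1) := by
  obtain ⟨k, hk, rfl⟩ := hy
  exact iterate_T_mem (Set.Ioo_subset_Ico_self hk) k

lemma Residue.exists (h : 1 < β) (x : ℝ) : ∃ y, Residue β x y := by
  have h0 : Filter.Tendsto (fun k : ℕ => x / (-β) ^ k) Filter.atTop (nhds 0) := by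
    have : Filter.Tendsto (fun k : ℕ => x * (-β)⁻¹ ^ k) Filter.atTop (nhds (x * 0)) := by
      apply Filter.Tendsto.const_mul
      apply tendsto_pow_atTop_nhds_zero_of_abs_lt_one
      rw [abs_inv, abs_neg, abs_of_pos (by linarith : 0 < β)]
      exact inv_lt_one_of_one_lt₀ h
    simpa only [div_eq_mul_inv, inv_pow, mul_zero] using this
  obtain ⟨k, hk⟩ := (h0.eventually (Ioo_mem_nhds (leftEnd_neg h)
    (by linarith [neg_one_lt_leftEnd h] : (0 : ℝ) < leftEnd β + 1))).exists
  exact ⟨_, k, hk, rfl⟩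

/-! ### Conjugate windows for quadratic units -/

/-- A relation between a residue and the conjugate of the integer part that is preserved by
appending a digit holds for all residues; here `β² = Aβ + B` and `A - β` is the conjugate
of `β`. -/
lemma Residue.induction {A B : ℤ} (hq : β ^ 2 = A * β + B)
    {Inv : ℝ → ℝ → Prop}
    (h0 : ∀ y ∈ Set.Ioo (leftEnd β) (leftEnd β + 1), Inv y 0)
    (hs : ∀ y ∈ Set.Ico (leftEnd β) (leftEnd β + 1),
      ∀ z ∈ Set.Ico (leftEnd β) (leftEnd β + 1), ∀ (d : ℤ) (s : ℝ), z = -β * y - d →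
      Inv y s → Inv z (-(A - β) * s + d))
    (h : 1 < β) {x y : ℝ} (hxy : Residue β x y) :
    ∃ a c : ℤ, x = y + a + c * β ∧ Inv y (a + c * (A - β)) := by
  obtain ⟨k, hk, rfl⟩ := hxy
  have hx : x = (-β) ^ k * (x / (-β) ^ k) := by
    have : (-β) ^ k ≠ 0 := pow_ne_zero _ (by linarith)
    field_simp
  set y₀ := x / (-β) ^ k
  rw [hx]
  have hy₀ := Set.Ioo_subset_Ico_self hk
  clear_value y₀
  clear hx
  induction k with
  | zero => exact ⟨0, 0, by simp, by simpa using h0 _ hk⟩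
  | succ k ih =>
    obtain ⟨a, c, hac, hI⟩ := ih
    have e := iterate_T_succ (β := β) y₀ k
    -- The new integer part is `d - β(a + cβ)`, reduced by `β² = Aβ + B`; its conjugate is `d -
    -- β's`.
    refine ⟨digit β y₀ k - c * B, -a - c * A, ?_, ?_⟩
    · rw [pow_succ', mul_assoc, hac, e]
      push_cast
      linear_combination (-c : ℝ) * hq
    · have := hs _ (iterate_T_mem hy₀ k) _ (iterate_T_mem hy₀ (k + 1)) _ _ e hI
      convert this using 1
      push_cast
      linear_combination (c : ℝ) * hq

/-- If the residue invariant `Inv` recognises the residue `0` by a window `[w, w + κ)` for the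
conjugate, then `ℤ_{-β}` is the cut-and-project set with that window. -/
lemma negBetaIntegers_eq_of_window {A B : ℤ} (hq : β ^ 2 = A * β + B) (h : 1 < β)
    {Inv : ℝ → ℝ → Prop}
    (h0 : ∀ y ∈ Set.Ioo (leftEnd β) (leftEnd β + 1), Inv y 0)
    (hs : ∀ y ∈ Set.Ico (leftEnd β) (leftEnd β + 1),
      ∀ z ∈ Set.Ico (leftEnd β) (leftEnd β + 1), ∀ (d : ℤ) (s : ℝ), z = -β * y - d →
      Inv y s → Inv z (-(A - β) * s + d))
    {w κ : ℝ} (hw : ∀ s, Inv 0 s → w ≤ s ∧ s < w + κ)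
    (hu : ∀ (a c : ℤ) (s t : ℝ), (a + c * β : ℝ) ∈ Set.Ico (leftEnd β) (leftEnd β + 1) →
      w ≤ s → s < w + κ → Inv (a + c * β) t → s - t = a + c * (A - β) → (a + c * β : ℝ) = 0) :
    negBetaIntegers β =
      {x | ∃ a c : ℤ, x = a + c * β ∧ w ≤ a + c * (A - β) ∧ a + c * (A - β) < w + κ} := by
  ext x
  rw [mem_negBetaIntegers_iff h, Set.mem_ofPred_eq]
  constructor
  · intro hx
    obtain ⟨a, c, e, hI⟩ := Residue.induction hq h0 hs h hx
    exact ⟨a, c, by rw [e]; ring, hw _ hI⟩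
  · rintro ⟨a, c, e, h1, h2⟩
    obtain ⟨y, hy⟩ := Residue.exists h x
    obtain ⟨a', c', e', hI⟩ := Residue.induction hq h0 hs h hy
    have ey : y = ((a - a' : ℤ) : ℝ) + ((c - c' : ℤ) : ℝ) * β := by
      push_cast; linarith
    -- The residue lies in `ℤ + ℤβ`, and its conjugate is a window point minus the conjugate of the
    -- integer part.
    have := hu (a - a') (c - c') _ (a' + c' * (A - β)) (ey ▸ hy.mem) h1 h2 (ey ▸ hI)
      (by push_cast; ring)
    rw [← ey] at this
    rwa [← this]

/-- The residue invariant for `β² = mβ + 1`. -/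
def UnitInvNeg (m : ℤ) (β y s : ℝ) : Prop :=
  0 ≤ s ∧ s < β + 1 ∧ (leftEnd β + (β - m) < y → s < β) ∧ (y = leftEnd β → 1 ≤ s)

lemma unitInvNeg_zero (h : 1 < β) {m : ℤ} (y : ℝ)
    (hy : y ∈ Set.Ioo (leftEnd β) (leftEnd β + 1)) : UnitInvNeg m β y 0 :=
  ⟨le_rfl, by linarith, fun _ => by linarith, fun e => absurd e hy.1.ne'⟩

/-- Here `-β' = β - m = 1/β`, so the new `s` is `s/β + d`, and `0 ≤ d ≤ m` gives the range `[0, β +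
1)`. The two extra clauses depend on the digit alone: `z > l + 1/β` forces `d ≤ m - 1`, and `z = l`
forces `d ≥ 1`. -/
lemma unitInvNeg_step (h : 1 < β) {m : ℤ} (hm : β * (β - m) = 1) (y : ℝ)
    (hy : y ∈ Set.Ico (leftEnd β) (leftEnd β + 1)) (z : ℝ)
    (hz : z ∈ Set.Ico (leftEnd β) (leftEnd β + 1)) (d : ℤ) (s : ℝ) (e : z = -β * y - d)
    (hI : UnitInvNeg m β y s) : UnitInvNeg m β z (-(m - β) * s + d) := by
  obtain ⟨h1, h2, -, -⟩ := hI
  have hl := mul_leftEnd h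
  have hb : 0 < β - m := by
    by_contra hb
    nlinarith
  have hb1 : β - m < 1 := by nlinarith
  have hy1 : β * leftEnd β ≤ β * y := by nlinarith [hy.1]
  have hy2 : β * y < β * leftEnd β + β := by nlinarith [hy.2]
  have hs0 : 0 ≤ (β - m) * s := by positivity
  have hs1 : (β - m) * s < 1 + (β - m) := by nlinarith
  have hd0 : (0 : ℤ) ≤ d := by
    have : (-1 : ℝ) < d := by linarith [hz.2]
    have : (-1 : ℤ) < d := by exact_mod_cast this
    omega
  have hd0' : (0 : ℝ) ≤ d := by exact_mod_cast hd0
  have hdm : (d : ℝ) ≤ m := by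
    have : (d : ℝ) < m + 1 := by linarith [hz.1]
    have : d < m + 1 := by exact_mod_cast this
    exact_mod_cast (by omega : d ≤ m)
  refine ⟨by linarith, by linarith, fun hp => ?_, fun hz' => ?_⟩
  · have : (d : ℝ) < m := by linarith
    have : d < m := by exact_mod_cast this
    have : (d : ℝ) ≤ m - 1 := by exact_mod_cast (by omega : d ≤ m - 1)
    linarith
  · have : (0 : ℝ) < d := by linarith
    have : 0 < d := by exact_mod_cast this
    have : (1 : ℝ) ≤ d := by exact_mod_cast (by omega : 1 ≤ d)
    linarith

lemma exists_shift (a c m : ℤ) (β : ℝ) :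
    ∃ a' : ℤ, (a + c * β : ℝ) = a' + c * (β - m) ∧ (a + c * (m - β) : ℝ) = a' - c * β :=
  ⟨a + c * m, by push_cast; ring, by push_cast; ring⟩

/-- For `m ≥ 2` the threshold `l + 1/β` is negative, so the sharper bound `s < β` holds at residue
`0`. -/
lemma negBetaIntegers_eq_of_norm_neg_one (h : 1 < β) {m : ℤ} (hm2 : 2 ≤ m)
    (hm : β * (β - m) = 1) :
    negBetaIntegers β =
      {x | ∃ a c : ℤ, x = a + c * β ∧ (0 : ℝ) ≤ a + c * (m - β) ∧ a + c * (m - β) < 0 + β} := by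
  have hm2' : (2 : ℝ) ≤ m := by exact_mod_cast hm2
  have hl := mul_leftEnd h
  have hl0 := leftEnd_neg h
  have hl1 := neg_one_lt_leftEnd h
  have hb : 0 < β - m := by
    by_contra hb
    nlinarith
  have hp : leftEnd β + (β - m) < 0 := by nlinarith
  refine negBetaIntegers_eq_of_window (B := 1) (by push_cast; linarith) h
    (unitInvNeg_zero h) (unitInvNeg_step h hm) ?_ ?_
  · rintro s ⟨h1, -, h2, -⟩
    exact ⟨h1, by linarith [h2 hp]⟩
  · intro a c s t hy hs0 hs1 hI e
    obtain ⟨a', e1, e2⟩ := exists_shift a c m β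
    rw [e1] at hy hI ⊢
    rw [e2] at e
    obtain ⟨ht0, ht1, ht2, -⟩ := hI
    obtain ⟨hy1, hy2⟩ := hy
    rcases lt_trichotomy c 0 with hc | rfl | hc
    · have hc' : (c : ℝ) ≤ -1 := by exact_mod_cast (by omega : c ≤ -1)
      have : (a' : ℝ) < 0 := by nlinarith
      have : a' < 0 := by exact_mod_cast this
      have : (a' : ℝ) ≤ -1 := by exact_mod_cast (by omega : a' ≤ -1)
      nlinarith
    · have : (-1 : ℝ) < a' := by push_cast at hy1; linarith
      have : -1 < a' := by exact_mod_cast this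
      have : (a' : ℝ) < 1 := by push_cast at hy2; linarith
      have : a' < 1 := by exact_mod_cast this
      have : a' = 0 := by omega
      simp [this]
    · have hc' : (1 : ℝ) ≤ c := by exact_mod_cast (by omega : 1 ≤ c)
      have : (-1 : ℝ) < a' := by nlinarith
      have : -1 < a' := by exact_mod_cast this
      have ha0 : (0 : ℝ) ≤ a' := by exact_mod_cast (by omega : 0 ≤ a')
      have : leftEnd β + (β - m) < a' + c * (β - m) := by nlinarith
      have := ht2 this
      have : (0 : ℝ) < a' := by nlinarith
      have : 0 < a' := by exact_mod_cast this
      have : (1 : ℝ) ≤ a' := by exact_mod_cast (by omega : 1 ≤ a')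
      nlinarith

/-- For `m = 1` the threshold `l + 1/β` equals `0` and is not passed by residue `0`, so the window
is longer. The residue `l = -1/β` itself lies in `ℤ + ℤβ`, and only the clause for `y = l` excludes
it. -/
lemma negBetaIntegers_eq_of_golden (h : 1 < β) (hm : β * (β - 1) = 1) :
    negBetaIntegers β =
      {x | ∃ a c : ℤ, x = a + c * β ∧ (0 : ℝ) ≤ a + c * ((1 : ℤ) - β) ∧
        a + c * ((1 : ℤ) - β) < 0 + (β + 1)} := by
  have hl := mul_leftEnd h
  have hl0 := leftEnd_neg h
  have hl1 := neg_one_lt_leftEnd h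
  have hb : 0 < β - 1 := by linarith
  have hp : leftEnd β = -(β - 1) := by nlinarith
  have hm' : β * (β - (1 : ℤ)) = 1 := by push_cast; exact hm
  refine negBetaIntegers_eq_of_window (B := 1) (by push_cast; linarith) h
    (unitInvNeg_zero h) (unitInvNeg_step h hm') ?_ ?_
  · rintro s ⟨h1, h2, -, -⟩
    exact ⟨h1, by linarith⟩
  · intro a c s t hy hs0 hs1 hI e
    obtain ⟨a', e1, e2⟩ := exists_shift a c 1 β
    rw [e1] at hy hI ⊢
    rw [e2] at e
    obtain ⟨ht0, ht1, ht2, ht3⟩ := hI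
    obtain ⟨hy1, hy2⟩ := hy
    push_cast at *
    rw [hp] at hy1 hy2 ht2 ht3
    rcases lt_trichotomy c 0 with hc | rfl | hc
    · have hc' : (c : ℝ) ≤ -1 := by exact_mod_cast (by omega : c ≤ -1)
      have : (a' : ℝ) < 1 := by nlinarith
      have : a' < 1 := by exact_mod_cast this
      have ha0 : (a' : ℝ) ≤ 0 := by exact_mod_cast (by omega : a' ≤ 0)
      have hc1 : (-1 : ℝ) ≤ c := by nlinarith
      have hc2 : (c : ℝ) = -1 := le_antisymm hc' hc1
      have : (-1 : ℝ) < a' := by rw [hc2] at hy1; linarith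
      have : -1 < a' := by exact_mod_cast this
      have ha : a' = 0 := by omega
      rw [hc2, ha] at ht3 e
      have := ht3 (by push_cast; ring)
      push_cast at e
      linarith
    · have : (-1 : ℝ) < a' := by push_cast at hy1; linarith
      have : -1 < a' := by exact_mod_cast this
      have : (a' : ℝ) < 1 := by push_cast at hy2; linarith
      have : a' < 1 := by exact_mod_cast this
      have : a' = 0 := by omega
      simp [this]
    · have hc' : (1 : ℝ) ≤ c := by exact_mod_cast (by omega : 1 ≤ c)
      have : (-1 : ℝ) < a' := by nlinarith
      have : -1 < a' := by exact_mod_cast this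
      have ha0 : (0 : ℝ) ≤ a' := by exact_mod_cast (by omega : 0 ≤ a')
      have : -(β - 1) + (β - 1) < a' + c * (β - 1) := by nlinarith
      have := ht2 this
      have : (0 : ℝ) < a' := by nlinarith
      have : 0 < a' := by exact_mod_cast this
      have : (1 : ℝ) ≤ a' := by exact_mod_cast (by omega : 1 ≤ a')
      nlinarith

lemma exists_shift_neg (a c m : ℤ) (β : ℝ) :
    ∃ a' c' : ℤ, (a + c * β : ℝ) = a' + c' * (m - β) ∧ (a + c * (m - β) : ℝ) = a' + c' * β :=
  ⟨a + c * m, -c, by push_cast; ring, by push_cast; ring⟩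

/-- The residue invariant for `β² = mβ - 1`. -/
def UnitInvPos (m : ℤ) (β y s : ℝ) : Prop :=
  -((β - 1) / (β + 1)) < s ∧ s < β * ((β - 1) / (β + 1)) + 1 ∧
    (leftEnd β + 1 - (m - β) < y → s < β * ((β - 1) / (β + 1)))

lemma negBetaIntegers_eq_of_norm_one (h : 1 < β) {m : ℤ} (hm3 : 3 ≤ m)
    (hm : β * (m - β) = 1) :
    negBetaIntegers β =
      {x | ∃ a c : ℤ, x = a + c * β ∧ -((β - 1) / (β + 1)) ≤ a + c * (m - β) ∧
        a + c * (m - β) < -((β - 1) / (β + 1)) + (β - 1)} := by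
  have hm3' : (3 : ℝ) ≤ m := by exact_mod_cast hm3
  have hl := mul_leftEnd h
  have hl0 := leftEnd_neg h
  have hl1 := neg_one_lt_leftEnd h
  have hb : 0 < m - β := by
    by_contra hb
    nlinarith
  have hb1 : m - β < 1 := by nlinarith
  have hβ : 2 < β := by linarith
  set q := (β - 1) / (β + 1) with hqdef
  have hq : β * q = β - 1 - q := by rw [hqdef]; field_simp; ring
  have hq0 : 0 < q := by rw [hqdef]; apply div_pos <;> linarith
  have hq1 : q < 1 := by rw [hqdef, div_lt_one] <;> linarith
  have hbl : (m - β) * (β * (leftEnd β + 1)) = leftEnd β + 1 := by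
    linear_combination (leftEnd β + 1) * hm
  have hbq : (m - β) * (β * q) = q := by linear_combination q * hm
  have hbl1 : m - β > leftEnd β + 1 := by nlinarith
  refine negBetaIntegers_eq_of_window (B := -1) (Inv := UnitInvPos m β)
    (by push_cast; linarith) h ?_ ?_ ?_ ?_
  · intro y hy
    refine ⟨by linarith, ?_, fun _ => ?_⟩ <;> rw [← hqdef] <;> nlinarith
  · rintro y hy z hz d s e ⟨h1, h2, h3⟩
    rw [← hqdef] at h1 h2 h3
    have hy1 : β * leftEnd β ≤ β * y := by nlinarith [hy.1]
    have hy2 : β * y < β * leftEnd β + β := by nlinarith [hy.2]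
    have hd0 : (0 : ℤ) ≤ d := by
      have : (-1 : ℝ) < d := by linarith [hz.2]
      have : (-1 : ℤ) < d := by exact_mod_cast this
      omega
    have hdm : (d : ℝ) ≤ m - 1 := by
      have : (d : ℝ) < m := by linarith [hz.1]
      have : d < m := by exact_mod_cast this
      exact_mod_cast (by omega : d ≤ m - 1)
    have hp : leftEnd β + 1 - (m - β) < z → (d : ℝ) ≤ m - 2 := by
      intro hp
      have : (d : ℝ) < m - 1 := by linarith
      have : d < m - 1 := by exact_mod_cast this
      exact_mod_cast (by omega : d ≤ m - 2)
    have hsl : (m - β) * s > (m - β) * -q := mul_lt_mul_of_pos_left h1 hb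
    have hsu : (m - β) * s < q + (m - β) := by nlinarith
    have hbq' : (m - β) * q = 1 - (m - β) - q := by
      linear_combination (m - β) * hq - hbq + hm
    refine ⟨?_, ?_, fun hz' => ?_⟩
    · rw [← hqdef]
      rcases eq_or_lt_of_le hd0 with rfl | hd
      -- Digit `0` means `y > -(l + 1)/β`, which is exactly the threshold `l + 1 - 1/β`, so `s <
      -- βq`.
      · have := h3 (by push_cast at e; nlinarith [hz.2])
        have : (m - β) * s < q := by nlinarith
        push_cast
        linarith
      · have : (1 : ℝ) ≤ d := by exact_mod_cast (by omega : 1 ≤ d)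
        nlinarith
    · rw [← hqdef]; linarith
    · rw [← hqdef]; linarith [hp hz']
  · rintro s ⟨h1, -, h2⟩
    rw [← hqdef] at h1 h2
    exact ⟨h1.le, by linarith [h2 (by linarith)]⟩
  · intro a c s t hy hs0 hs1 hI e
    obtain ⟨a', c', e1, e2⟩ := exists_shift_neg a c m β
    rw [e1] at hy hI ⊢
    rw [e2] at e
    obtain ⟨ht0, ht1, ht2⟩ := hI
    rw [← hqdef] at ht0 ht1 ht2
    obtain ⟨hy1, hy2⟩ := hy
    have hβb : 0 < β - (m - β) := by linarith
    rcases lt_trichotomy c' 0 with hc | rfl | hc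
    · exfalso
      have hc1 : (c' : ℝ) ≤ -1 := by exact_mod_cast (by omega : c' ≤ -1)
      have hc2 : (c' + 1) * (β - (m - β)) ≤ 0 :=
        mul_nonpos_of_nonpos_of_nonneg (by linarith) hβb.le
      by_cases hp : leftEnd β + 1 - (m - β) < a' + c' * (m - β)
      · have := ht2 hp
        have : leftEnd β + (m - β) < 0 := by nlinarith
        linarith
      · rcases eq_or_lt_of_le (by omega : c' ≤ -1) with rfl | hc
        · push_cast at *
          have : (0 : ℝ) < a' := by linarith
          have : 0 < a' := by exact_mod_cast this
          have : (1 : ℝ) ≤ a' := by exact_mod_cast (by omega : 1 ≤ a')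
          linarith
        · have hc3 : (c' : ℝ) ≤ -2 := by exact_mod_cast (by omega : c' ≤ -2)
          have : (c' + 2) * (β - (m - β)) ≤ 0 :=
            mul_nonpos_of_nonpos_of_nonneg (by linarith) hβb.le
          linarith
    · have : (-1 : ℝ) < a' := by push_cast at hy1; linarith
      have : -1 < a' := by exact_mod_cast this
      have : (a' : ℝ) < 1 := by push_cast at hy2; linarith
      have : a' < 1 := by exact_mod_cast this
      have : a' = 0 := by omega
      simp [this]
    · exfalso
      rcases eq_or_lt_of_le (by omega : 1 ≤ c') with rfl | hc
      · push_cast at *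
        have : (a' : ℝ) < -1 := by linarith
        have : a' < -1 := by exact_mod_cast this
        have : (a' : ℝ) ≤ -2 := by exact_mod_cast (by omega : a' ≤ -2)
        linarith
      · have hc3 : (2 : ℝ) ≤ c' := by exact_mod_cast (by omega : 2 ≤ c')
        have : 0 ≤ (c' - 2) * (β - (m - β)) := mul_nonneg (by linarith) hβb.le
        linarith

/-! ### Sturmian words from Beatty sequences -/

/-- Makes every coding word share the gaps of one explicit enumeration. -/
lemma strictMono_eq_of_range_eq {t t' : ℤ → ℝ} (ht : StrictMono t) (ht' : StrictMono t')
    (h0 : t 0 = t' 0) (hr : Set.range t = Set.range t') : t = t' := by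
  have hm : ∀ j, ∃ i, t' i = t j := fun j => by
    have : t j ∈ Set.range t' := hr ▸ ⟨j, rfl⟩
    exact this
  have hm' : ∀ i, ∃ j, t j = t' i := fun j => by
    have : t' j ∈ Set.range t := hr ▸ ⟨j, rfl⟩
    exact this
  choose e he using hm
  have hmono : StrictMono e := fun i j hij => by
    rw [← ht'.lt_iff_lt, he, he]; exact ht hij
  have hsucc : ∀ j, e (j + 1) = e j + 1 := by
    intro j
    have h1 : e j < e (j + 1) := hmono (by omega)
    obtain ⟨k, hk⟩ := hm' (e j + 1)
    have h2 : t j < t k := by rw [hk, ← he j]; exact ht' (by omega)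
    have h3 : j < k := ht.lt_iff_lt.mp h2
    have h4 : t (j + 1) ≤ t k := ht.monotone (by omega)
    rw [hk, ← he, ht'.le_iff_le] at h4
    omega
  have hzero : e 0 = 0 := ht'.injective (by rw [he, h0])
  have hid : ∀ j, e j = j := by
    intro j
    induction j using Int.induction_on with
    | zero => exact hzero
    | succ i ih => rw [hsucc, ih]
    | pred i ih =>
      have := hsucc (-i - 1)
      rw [sub_add_cancel, ih] at this
      omega
  ext j
  rw [← he j, hid]

open Classical in
/-- If `Q` increases by one exactly at the occurrences of `a`, it counts them. -/
lemma count_factor {A : Type*} {u : ℤ → A} {a : A} {Q : ℤ → ℤ}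
    (hQ : ∀ j, Q (j + 1) - Q j = if u j = a then 1 else 0) (i : ℤ) (n : ℕ) :
    ((((List.range n).map fun j : ℕ => u (i + j)).count a : ℕ) : ℤ) = Q (i + n) - Q i := by
  induction n with
  | zero => simp
  | succ n ih =>
    rw [List.range_succ, List.map_append, List.count_append]
    push_cast
    rw [ih, List.map_singleton, List.count_singleton]
    have := hQ (i + n)
    rw [← add_assoc]
    by_cases h : u (i + n) = a
    · simp [h] at this ⊢; omega
    · simp [h] at this ⊢; omega

section Beatty

variable {A : Type*} {u : ℤ → A} {P : ℤ → ℤ} {κ : ℝ}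

/-- Along the progression the deviation is `k |c - p/κ| < 1` for all `k`, which forces `cκ = p`. -/
lemma no_arithmetic_progression (hirr : ∀ c p : ℤ, p ≠ 0 → (c * κ : ℝ) ≠ p)
    (hκ : 0 < κ) (hP : ∀ i n : ℤ, |((P (i + n) - P i : ℤ) : ℝ) - n / κ| < 1)
    {N p c : ℤ} (hp : p ≠ 0) (h : ∀ k : ℕ, P (N + k * p) = P N + k * c) : False := by
  apply hirr c p hp
  by_contra hne
  have hne' : (c : ℝ) - p / κ ≠ 0 := by
    intro h0
    apply hne
    field_simp at h0
    linarith
  have hpos := abs_pos.mpr hne'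
  obtain ⟨k, hk⟩ := exists_nat_gt (1 / |(c : ℝ) - p / κ|)
  rw [div_lt_iff₀ hpos] at hk
  have h1 := hP N (k * p)
  rw [h k] at h1
  have : (((P N + k * c - P N : ℤ) : ℝ) - ((k * p : ℤ) : ℝ) / κ) = k * ((c : ℝ) - p / κ) := by
    push_cast; ring
  rw [this, abs_mul, Nat.abs_cast] at h1
  linarith

/-- An eventual period `p` makes `P` an arithmetic progression along multiples of `p`. For balance,
two increments within `1` of the same `n/κ` are integers less than `2` apart. -/
lemma isSturmian_of_beatty (hirr : ∀ c p : ℤ, p ≠ 0 → (c * κ : ℝ) ≠ p)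
    (hκ : 0 < κ) (hP : ∀ i n : ℤ, |((P (i + n) - P i : ℤ) : ℝ) - n / κ| < 1)
    (hstep : ∀ j, P (j + 1) - P j = 0 ∨ P (j + 1) - P j = 1)
    (hu : ∀ i j, u i = u j ↔ P (i + 1) - P i = P (j + 1) - P j) : IsSturmian u := by
  classical
  have hap : IsAperiodic u := by
    constructor
    · rintro ⟨N, p, hp, h⟩
      have hD : ∀ k : ℕ, P (N + k + p) - P (N + k) = P (N + p) - P N := by
        intro k
        induction k with
        | zero => simp
        | succ k ih =>
          have := (hu _ _).mp (h (N + k) (by omega))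
          rw [add_right_comm _ p 1] at this
          push_cast
          rw [← add_assoc]
          omega
      refine no_arithmetic_progression hirr hκ hP (N := N) hp.ne' (c := P (N + p) - P N) ?_
      intro k
      induction k with
      | zero => simp
      | succ k ih =>
        have := hD (k * p.toNat)
        push_cast at this ⊢
        rw [Int.toNat_of_nonneg hp.le] at this
        rw [add_one_mul, ← add_assoc]
        linarith
    · rintro ⟨N, p, hp, h⟩
      have hD : ∀ k : ℕ, P (N - k - p) - P (N - k) = P (N - p) - P N := by
        intro k
        induction k with
        | zero => simp
        | succ k ih =>
          have := (hu _ _).mp (h (N - (k + 1)) (by omega))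
          rw [show N - ((k : ℤ) + 1) - p + 1 = N - k - p by ring,
            show N - ((k : ℤ) + 1) + 1 = N - k by ring] at this
          push_cast
          omega
      refine no_arithmetic_progression hirr hκ hP (N := N) (neg_ne_zero.mpr hp.ne')
        (c := P (N - p) - P N) ?_
      intro k
      induction k with
      | zero => simp
      | succ k ih =>
        have := hD (k * p.toNat)
        push_cast at this ⊢
        rw [Int.toNat_of_nonneg hp.le] at this
        rw [show N + ((k : ℤ) + 1) * -p = N - k * p - p by ring]
        rw [show N + (k : ℤ) * -p = N - k * p by ring] at ih
        linarith
  refine ⟨?_, hap, ?_⟩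
  · have hex : ∃ j, u j ≠ u 0 := by
      by_contra hall
      push Not at hall
      exact hap.1 ⟨0, 1, one_pos, fun i _ => by rw [hall, hall i]⟩
    obtain ⟨j, hj⟩ := hex
    rw [Set.ncard_eq_two]
    refine ⟨u j, u 0, hj, ?_⟩
    ext x
    constructor
    · rintro ⟨i, rfl⟩
      rw [Set.mem_insert_iff, Set.mem_singleton_iff, hu, hu]
      rw [Ne, hu] at hj
      have := hstep i
      have := hstep j
      have := hstep 0
      omega
    · rintro (rfl | rfl) <;> exact ⟨_, rfl⟩
  · have hdiff : ∀ i i' n : ℤ, |(P (i + n) - P i) - (P (i' + n) - P i')| ≤ 1 := by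
      intro i i' n
      have h1 := abs_lt.mp (hP i n)
      have h2 := abs_lt.mp (hP i' n)
      have h3 : (((P (i + n) - P i) - (P (i' + n) - P i') : ℤ) : ℝ) < 2 := by
        push_cast at *; linarith
      have h4 : (-2 : ℝ) < (((P (i + n) - P i) - (P (i' + n) - P i') : ℤ) : ℝ) := by
        push_cast at *; linarith
      have h5 : (P (i + n) - P i) - (P (i' + n) - P i') < 2 := by exact_mod_cast h3
      have h6 : -2 < (P (i + n) - P i) - (P (i' + n) - P i') := by exact_mod_cast h4
      rw [abs_le]; omega
    rintro w v ⟨i, hw⟩ ⟨i', hv⟩ hlen a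
    rw [← hlen] at hv
    generalize w.length = n at hw hv
    by_cases hex : ∃ j, u j = a
    · obtain ⟨j, rfl⟩ := hex
      rcases hstep j with hj | hj
      -- The letter on which `P` is constant is counted by `k - P k`.
      · have hQ : ∀ k, (k + 1 - P (k + 1)) - (k - P k) = if u k = u j then 1 else 0 := by
          intro k
          split_ifs with hk <;> rw [hu] at hk <;> have := hstep k <;> omega
        rw [hw, hv, count_factor (Q := fun k => k - P k) hQ,
          count_factor (Q := fun k => k - P k) hQ]
        have := hdiff i i' n
        rw [abs_le] at this ⊢
        omega
      · have hQ : ∀ k, P (k + 1) - P k = if u k = u j then 1 else 0 := by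
          intro k
          split_ifs with hk <;> rw [hu] at hk <;> have := hstep k <;> omega
        rw [hw, hv, count_factor hQ, count_factor hQ]
        exact hdiff i i' n
    · push Not at hex
      have hQ : ∀ k, (0 : ℤ) - 0 = if u k = a then 1 else 0 := by
        intro k; rw [if_neg (hex k)]; rfl
      rw [hw, hv, count_factor (Q := fun _ => 0) hQ, count_factor (Q := fun _ => 0) hQ]
      simp

end Beatty

/-- The Beatty enumeration of a cut-and-project set with window `[w, w + κ)`. -/
lemma exists_beatty_enumeration {β β' κ w : ℝ} {r : ℤ} (hκ : κ = r + 1 - β') (hκ1 : 1 < κ)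
    (hw0 : w ≤ 0) (hw1 : 0 < w + κ) (hr : r < β)
    (hZ : negBetaIntegers β =
      {x | ∃ a c : ℤ, x = a + c * β ∧ w ≤ a + c * β' ∧ a + c * β' < w + κ}) :
    ∃ P : ℤ → ℤ, (∀ j, P (j + 1) - P j = 0 ∨ P (j + 1) - P j = 1) ∧
      (∀ i n : ℤ, |((P (i + n) - P i : ℤ) : ℝ) - n / κ| < 1) ∧
      StrictMono (fun j : ℤ => (j + P j * (β - r - 1) : ℝ)) ∧
      ((0 : ℤ) + P 0 * (β - r - 1) : ℝ) = 0 ∧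
      Set.range (fun j : ℤ => (j + P j * (β - r - 1) : ℝ)) = negBetaIntegers β := by
  have hκ0 : 0 < κ := by linarith
  have hstep : ∀ j : ℤ, ⌊((j + 1 : ℤ) - w) / κ⌋ - ⌊((j : ℤ) - w) / κ⌋ = 0 ∨
      ⌊((j + 1 : ℤ) - w) / κ⌋ - ⌊((j : ℤ) - w) / κ⌋ = 1 := by
    intro j
    have e : (((j + 1 : ℤ) : ℝ) - w) / κ = (j - w) / κ + 1 / κ := by push_cast; ring
    have h1 : 1 / κ < 1 := by rw [div_lt_one hκ0]; exact hκ1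
    have h2 : 0 < 1 / κ := by positivity
    rw [e]
    have a1 := Int.floor_le ((j - w) / κ + 1 / κ)
    have a2 := Int.lt_floor_add_one ((j - w) / κ + 1 / κ)
    have a3 := Int.floor_le ((j - w) / κ)
    have a4 := Int.lt_floor_add_one ((j - w) / κ)
    have b1 : (⌊(j - w) / κ + 1 / κ⌋ : ℝ) < ⌊(j - w) / κ⌋ + 2 := by linarith
    have b2 : (⌊(j - w) / κ⌋ : ℝ) < ⌊(j - w) / κ + 1 / κ⌋ + 1 := by linarith
    have b1' : ⌊(j - w) / κ + 1 / κ⌋ < ⌊(j - w) / κ⌋ + 2 := by exact_mod_cast b1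
    have b2' : ⌊(j - w) / κ⌋ < ⌊(j - w) / κ + 1 / κ⌋ + 1 := by exact_mod_cast b2
    omega
  -- Put `j = a + c(r + 1)`. Then `a + cβ' = j - κc`, so the window condition says `c = ⌊(j -
  -- w)/κ⌋`: each `j` carries exactly one point, `a + cβ = j + c(β - r - 1)`.
  refine ⟨fun j => ⌊((j : ℤ) - w) / κ⌋, hstep, ?_, ?_, ?_, ?_⟩
  · intro i n
    have e : (((i + n : ℤ) : ℝ) - w) / κ = (i - w) / κ + n / κ := by push_cast; ring
    have a1 := Int.floor_le ((((i + n : ℤ) : ℝ) - w) / κ)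
    have a2 := Int.lt_floor_add_one ((((i + n : ℤ) : ℝ) - w) / κ)
    have a3 := Int.floor_le ((i - w) / κ)
    have a4 := Int.lt_floor_add_one ((i - w) / κ)
    rw [abs_lt]
    constructor <;> push_cast at * <;> linarith
  · apply strictMono_int_of_lt_succ
    intro j
    rcases hstep j with h | h
    · rw [sub_eq_zero] at h
      beta_reduce
      rw [h]; push_cast; linarith
    · rw [sub_eq_iff_eq_add] at h
      beta_reduce
      rw [h]; push_cast; linarith
  · have : ⌊(((0 : ℤ) : ℝ) - w) / κ⌋ = 0 := by
      rw [Int.floor_eq_iff]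
      constructor
      · push_cast; apply div_nonneg <;> linarith
      · push_cast; rw [zero_add, div_lt_one hκ0]; linarith
    beta_reduce
    rw [this]; simp
  · rw [hZ]
    ext x
    rw [Set.mem_range, Set.mem_ofPred_eq]
    constructor
    · rintro ⟨j, rfl⟩
      have a3 := Int.floor_le ((j - w) / κ)
      have a4 := Int.lt_floor_add_one ((j - w) / κ)
      rw [le_div_iff₀ hκ0, hκ] at a3
      rw [div_lt_iff₀ hκ0, hκ] at a4
      refine ⟨j - ⌊(j - w) / κ⌋ * (r + 1), ⌊(j - w) / κ⌋, by push_cast; ring, ?_, ?_⟩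
      · push_cast; rw [hκ] at *; linarith
      · push_cast; rw [hκ] at *; linarith
    · rintro ⟨a, c, rfl, h1, h2⟩
      refine ⟨a + c * (r + 1), ?_⟩
      have : ⌊(((a + c * (r + 1) : ℤ) : ℝ) - w) / κ⌋ = c := by
        rw [Int.floor_eq_iff, le_div_iff₀ hκ0, div_lt_iff₀ hκ0]
        constructor
        · push_cast; rw [hκ] at *; linarith
        · push_cast; rw [hκ] at *; linarith
      simp only [this]
      push_cast; ring

/-- A cut-and-project set whose window has the length `κ = r + 1 - β'` is coded by words over two
letters, and each word coding it is Sturmian. -/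
lemma sturmian_of_window {β β' κ w : ℝ} {r : ℤ} (hκ : κ = r + 1 - β') (hκ1 : 1 < κ)
    (hw0 : w ≤ 0) (hw1 : 0 < w + κ) (hr : r < β) (hδ : β - r - 1 ≠ 0)
    (hirr : ∀ c p : ℤ, p ≠ 0 → (c * κ : ℝ) ≠ p)
    (hZ : negBetaIntegers β =
      {x | ∃ a c : ℤ, x = a + c * β ∧ w ≤ a + c * β' ∧ a + c * β' < w + κ}) :
    (∃ u : ℤ → Fin 2, IsCodingWord β u) ∧
      ∀ {A : Type*} (u : ℤ → A), IsCodingWord β u → IsSturmian u := by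
  obtain ⟨P, hstep, hP, hmono, h0, hrange⟩ := exists_beatty_enumeration hκ hκ1 hw0 hw1 hr hZ
  have hgap : ∀ j : ℤ, (((j + 1 : ℤ) : ℝ) + P (j + 1) * (β - r - 1)) - (j + P j * (β - r - 1)) =
      1 + ((P (j + 1) - P j : ℤ) : ℝ) * (β - r - 1) := by
    intro j; push_cast; ring
  constructor
  · refine ⟨fun j => if P (j + 1) - P j = 0 then 0 else 1,
      fun j => j + P j * (β - r - 1), ![1, 1 + (β - r - 1)], hmono, h0, hrange, ?_, ?_⟩
    · intro i j hij
      fin_cases i <;> fin_cases j <;> simp at hij ⊢ <;> exact hδ (by linarith)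
    · intro j
      simp only [hgap]
      rcases hstep j with h | h <;> simp [h]
  · rintro A u ⟨t, Δ, ht, ht0, htr, hΔ, hu⟩
    have e : t = fun j : ℤ => (j + P j * (β - r - 1) : ℝ) :=
      strictMono_eq_of_range_eq ht hmono (by rw [ht0]; exact h0.symm) (by rw [htr, hrange])
    refine isSturmian_of_beatty hirr (by linarith) hP hstep fun i j => ?_
    rw [← hΔ.eq_iff, ← hu, ← hu, e]
    simp only [hgap]
    rw [add_right_inj, mul_left_inj' hδ]
    norm_cast

/-! ### Quadratic integers and units -/

lemma int_combination_eq_zero (hirr : Irrational β) {a c : ℤ} (h : (a + c * β : ℝ) = 0) :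
    a = 0 ∧ c = 0 := by
  have hc : c = 0 := by
    by_contra hc
    apply hirr
    refine ⟨-a / c, ?_⟩
    have : (c : ℝ) ≠ 0 := by exact_mod_cast hc
    push_cast
    field_simp
    linarith
  subst hc
  exact ⟨by simpa using h, rfl⟩

lemma irrational_of_natDegree_minpoly {x : ℝ} (h : (minpoly ℚ x).natDegree = 2) :
    Irrational x := by
  intro hx
  have : (minpoly ℚ x).natDegree = 1 := minpoly.natDegree_eq_one_iff.mpr (by simpa using hx)
  omega

lemma exists_int_quadratic {x : ℝ} (hx : IsIntegral ℤ x) (h : (minpoly ℚ x).natDegree = 2) :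
    ∃ a c : ℤ, x ^ 2 = a * x + c := by
  have hd : (minpoly ℤ x).natDegree = 2 := by
    rw [minpoly.isIntegrallyClosed_eq_field_fractions' ℚ hx] at h
    rwa [(minpoly.monic hx).natDegree_map] at h
  have h0 := minpoly.aeval ℤ x
  rw [aeval_eq_sum_range, hd] at h0
  have h2 : (minpoly ℤ x).coeff 2 = 1 := by
    have := minpoly.monic hx
    rwa [Monic, leadingCoeff, hd] at this
  simp [Finset.sum_range_succ, h2] at h0
  exact ⟨-(minpoly ℤ x).coeff 1, -(minpoly ℤ x).coeff 0, by push_cast; linarith⟩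

lemma natDegree_minpoly_inv {x : ℝ} (hx : IsIntegral ℚ x) :
    (minpoly ℚ x⁻¹).natDegree = (minpoly ℚ x).natDegree := by
  rw [← IntermediateField.adjoin.finrank hx, ← IntermediateField.adjoin.finrank hx.inv]
  have : IntermediateField.adjoin ℚ {x⁻¹} = IntermediateField.adjoin ℚ {x} := by
    apply le_antisymm <;> rw [IntermediateField.adjoin_simple_le_iff]
    · exact inv_mem (IntermediateField.mem_adjoin_simple_self ℚ x)
    · simpa using inv_mem (IntermediateField.mem_adjoin_simple_self ℚ x⁻¹)
  rw [this]

lemma IsQuadraticPisotUnit.irrational (hq : IsQuadraticPisotUnit β) : Irrational β :=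
  irrational_of_natDegree_minpoly hq.2.1

/-- Comparing the integral equations of `β` and `β⁻¹` shows that the constant coefficient of `β` is
a unit of `ℤ`. In the norm `1` case `(β - 1)² > 0` gives `m > 2`. -/
lemma IsQuadraticPisotUnit.cases (h : 1 < β) (hq : IsQuadraticPisotUnit β) :
    ∃ m : ℤ, (1 ≤ m ∧ β * (β - m) = 1) ∨ (3 ≤ m ∧ β * (m - β) = 1) := by
  obtain ⟨-, hd, hi, hi'⟩ := hq
  have hirr := irrational_of_natDegree_minpoly hd
  obtain ⟨a, c, hac⟩ := exists_int_quadratic hi hd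
  obtain ⟨a', c', hac'⟩ := exists_int_quadratic hi' (by rw [natDegree_minpoly_inv hi.tower_top, hd])
  have e : (1 : ℝ) = a' * β + c' * β ^ 2 := by
    field_simp at hac'
    linarith
  rw [hac] at e
  have e' : ((c' * c - 1 : ℤ) : ℝ) + ((a' + c' * a : ℤ) : ℝ) * β = 0 := by
    push_cast; linarith
  have hcc : c' * c = 1 := by
    have := (int_combination_eq_zero hirr e').1
    omega
  rcases Int.eq_one_or_neg_one_of_mul_eq_one' hcc with ⟨-, rfl⟩ | ⟨-, rfl⟩
  · refine ⟨a, Or.inl ⟨?_, by push_cast at hac; linarith⟩⟩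
    push_cast at hac
    have : (0 : ℝ) < a := by
      by_contra hneg
      nlinarith
    have : 0 < a := by exact_mod_cast this
    omega
  · refine ⟨a, Or.inr ⟨?_, by push_cast at hac; linarith⟩⟩
    push_cast at hac
    have : (2 : ℝ) < a := by
      by_contra hneg
      nlinarith [sq_pos_of_pos (by linarith : 0 < β - 1)]
    have : 2 < a := by exact_mod_cast this
    omega

lemma isQuadraticPisotUnit_of_quadratic (h : 1 < β) (hirr : Irrational β) {A B : ℤ}
    (hq : β ^ 2 = A * β + B) (hB : B = 1 ∨ B = -1) (hβ' : |A - β| < 1) :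
    IsQuadraticPisotUnit β := by
  set p : ℤ[X] := X ^ 2 + (C (-A) * X + C (-B)) with hp
  have hdeg : (C (-A) * X + C (-B) : ℤ[X]).degree < (2 : ℕ) :=
    lt_of_le_of_lt degree_linear_le (by norm_num)
  have hmonic : p.Monic := monic_X_pow_add hdeg
  have hpdeg : p.natDegree = 2 := by
    rw [hp, natDegree_add_eq_left_of_degree_lt]
    · exact natDegree_X_pow 2
    · rw [degree_X_pow]; exact hdeg
  have hroot : aeval β p = 0 := by
    simp [hp]; linarith
  have hint : IsIntegral ℤ β := ⟨p, hmonic, hroot⟩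
  have hintQ : IsIntegral ℚ β := hint.tower_top
  refine ⟨⟨h, minpoly ℤ β, minpoly.monic hint,
    (minpoly.prime_of_isIntegrallyClosed hint).irreducible, minpoly.aeval _ _, ?_⟩, ?_, hint, ?_⟩
  · intro z hz hne
    obtain ⟨q, hq'⟩ := minpoly.isIntegrallyClosed_dvd hint hroot
    have hz' : aeval z p = 0 := by rw [hq', map_mul, hz, zero_mul]
    simp [hp] at hz'
    have hqC : (β : ℂ) ^ 2 = A * β + B := by exact_mod_cast hq
    have : (z - β) * (z - (A - β)) = 0 := by linear_combination hz' - hqC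
    rcases mul_eq_zero.mp this with h1 | h1
    · exact absurd (sub_eq_zero.mp h1) hne
    · rw [sub_eq_zero.mp h1]
      have : ((A : ℂ) - β) = ((A - β : ℝ) : ℂ) := by push_cast; rfl
      rw [this, Complex.norm_real]
      exact hβ'
  · apply le_antisymm
    · rw [minpoly.isIntegrallyClosed_eq_field_fractions' ℚ hint, (minpoly.monic hint).natDegree_map,
        ← hpdeg]
      exact natDegree_le_natDegree (minpoly.min ℤ β hmonic hroot)
    · rw [minpoly.two_le_natDegree_iff hintQ]
      intro hx
      exact hirr (by simpa using hx)
  · have hβ0 : β ≠ 0 := by linarith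
    rcases hB with rfl | rfl
    · have : β⁻¹ = β - (A : ℤ) := by
        push_cast at hq
        field_simp; linarith
      rw [this]
      exact hint.sub isIntegral_algebraMap
    · have : β⁻¹ = (A : ℤ) - β := by
        push_cast at hq
        field_simp; linarith
      rw [this]
      exact IsIntegral.sub isIntegral_algebraMap hint

lemma irrational_affine_ne (hirr : Irrational β) (n : ℤ) :
    ∀ c p : ℤ, p ≠ 0 → (c * (β + n) : ℝ) ≠ p := by
  intro c p hp e
  have := int_combination_eq_zero hirr (a := c * n - p) (c := c) (by push_cast; linarith)
  rw [this.2] at this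
  omega

/-- For a quadratic Pisot unit, coding words exist, and all of them are Sturmian. -/
lemma IsQuadraticPisotUnit.sturmian (h : 1 < β) (hq : IsQuadraticPisotUnit β) :
    (∃ u : ℤ → Fin 2, IsCodingWord β u) ∧
      ∀ {A : Type*} (u : ℤ → A), IsCodingWord β u → IsSturmian u := by
  have hirr := hq.irrational
  have hne : ∀ n : ℤ, β - n ≠ 0 := fun n e => hirr ⟨n, by push_cast; linarith⟩
  obtain ⟨m, ⟨hm1, hm⟩ | ⟨hm3, hm⟩⟩ := hq.cases h
  -- In each case `r` is read off from the window length `κ = r + 1 - β'`, which is `β + 1`, `β` or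
  -- `β - 1`.
  · rcases eq_or_lt_of_le hm1 with rfl | hm2
    · push_cast at hm
      refine sturmian_of_window (β' := (1 : ℤ) - β) (r := 1) ?_ ?_ ?_ ?_ ?_ ?_ ?_
        (negBetaIntegers_eq_of_golden h hm)
      · push_cast; ring
      · linarith
      · exact le_rfl
      · linarith
      · push_cast; linarith
      · intro e; exact hne 2 (by push_cast at *; linarith)
      · exact_mod_cast irrational_affine_ne hirr 1
    · refine sturmian_of_window (β' := m - β) (r := m - 1) ?_ ?_ ?_ ?_ ?_ ?_ ?_
        (negBetaIntegers_eq_of_norm_neg_one h hm2 hm)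
      · push_cast; ring
      · linarith
      · exact le_rfl
      · linarith
      · have : β - m > 0 := by
          by_contra hb
          nlinarith
        push_cast; linarith
      · intro e; exact hne m (by push_cast at *; linarith)
      · simpa using irrational_affine_ne hirr 0
  · have hm3' : (3 : ℝ) ≤ m := by exact_mod_cast hm3
    have hb : m - β < 1 := by nlinarith
    have hq1 : (β - 1) / (β + 1) < 1 := by rw [div_lt_one] <;> linarith
    have hq2 : (β - 1) / (β + 1) * (β + 1) = β - 1 := by field_simp
    have hq0 : 0 < (β - 1) / (β + 1) := by apply div_pos <;> linarith
    refine sturmian_of_window (β' := m - β) (r := m - 2) ?_ ?_ ?_ ?_ ?_ ?_ ?_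
      (negBetaIntegers_eq_of_norm_one h hm3 hm)
    · push_cast; ring
    · linarith
    · linarith
    · nlinarith
    · push_cast; linarith
    · intro e; exact hne (m - 1) (by push_cast at *; linarith)
    · have := irrational_affine_ne hirr (-1)
      push_cast at this
      exact this

/-! ### Points of `ℤ_{-β}` near `0` -/

/-- Below the golden ratio `-βl < 1`, so no nonzero digit can lead to residue `0`. Then `ℤ_{-β} =
{0}` and there is no coding word. -/
lemma eq_zero_of_lt_golden (h : 1 < β) (hg : β ^ 2 < β + 1) {x : ℝ}
    (hx : x ∈ negBetaIntegers β) : x = 0 := by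
  have hl := mul_leftEnd h
  have hl0 := leftEnd_neg h
  have hl1 := neg_one_lt_leftEnd h
  have key : ∀ y ∈ Set.Ico (leftEnd β) (leftEnd β + 1), T β y = 0 → y = 0 := by
    intro y hy hT
    unfold T at hT
    set d := ⌊-β * y - leftEnd β⌋
    have hbl : β * leftEnd β > -1 := by nlinarith
    have hy1 : β * leftEnd β ≤ β * y := by nlinarith [hy.1]
    have hy2 : β * y < β * leftEnd β + β := by nlinarith [hy.2]
    have h1 : (d : ℝ) < 1 := by linarith
    have h2 : (-1 : ℝ) < d := by linarith
    have h1' : d < 1 := by exact_mod_cast h1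
    have h2' : -1 < d := by exact_mod_cast h2
    have hd : d = 0 := by omega
    rw [hd] at hT
    have : β * y = 0 := by push_cast at hT; linarith
    rcases mul_eq_zero.mp this with h3 | h3
    · linarith
    · exact h3
  obtain ⟨k, hk, hT⟩ := (mem_negBetaIntegers_iff h).mp hx
  have : x / (-β) ^ k = 0 := by
    have hk' := Set.Ioo_subset_Ico_self hk
    clear hk
    generalize x / (-β) ^ k = y at hT hk'
    induction k with
    | zero => simpa using hT
    | succ k ih =>
      rw [Function.iterate_succ_apply'] at hT
      exact ih (key _ (iterate_T_mem hk' k) hT)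
  rcases div_eq_zero_iff.mp this with h1 | h1
  · exact h1
  · exact absurd h1 (pow_ne_zero _ (by linarith))

lemma neg_mul_mem_negBetaIntegers (h : 1 < β) {x : ℝ} (hx : x ∈ negBetaIntegers β) :
    -β * x ∈ negBetaIntegers β := by
  rw [mem_negBetaIntegers_iff h] at *
  simpa [T_zero h] using hx.map_T h

/-- A digit string is admissible once all its residues lie in `[l, l+1)`, the initial one in the
interior. In applications the residues are computed backwards from the final `0`. -/
lemma mem_negBetaIntegers_of_two_digits (h : 1 < β) (c e : ℤ) {y₁ y₂ : ℝ}
    (h1 : y₁ ∈ Set.Ioo (leftEnd β) (leftEnd β + 1)) (h2 : y₂ ∈ Set.Ico (leftEnd β) (leftEnd β + 1))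
    (e1 : y₂ = -β * y₁ - c) (e2 : 0 = -β * y₂ - e) {x : ℝ} (hx : x = -c * β + e) :
    x ∈ negBetaIntegers β := by
  rw [mem_negBetaIntegers_iff h]
  refine ((Residue.refl h1).step h c h2 rfl e1).step h e
    (Set.Ioo_subset_Ico_self (zero_mem_Ioo h)) ?_ e2
  rw [hx]
  linear_combination e2 + (-β) * e1

lemma mem_negBetaIntegers_of_three_digits (h : 1 < β) (d c e : ℤ) {y₀ y₁ y₂ : ℝ}
    (h0 : y₀ ∈ Set.Ioo (leftEnd β) (leftEnd β + 1)) (h1 : y₁ ∈ Set.Ico (leftEnd β) (leftEnd β + 1))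
    (h2 : y₂ ∈ Set.Ico (leftEnd β) (leftEnd β + 1))
    (e0 : y₁ = -β * y₀ - d) (e1 : y₂ = -β * y₁ - c) (e2 : 0 = -β * y₂ - e)
    {x : ℝ} (hx : x = d * β ^ 2 - c * β + e) :
    x ∈ negBetaIntegers β := by
  rw [mem_negBetaIntegers_iff h]
  refine (((Residue.refl h0).step h d h1 rfl e0).step h c h2 rfl e1).step h e
    (Set.Ioo_subset_Ico_self (zero_mem_Ioo h)) ?_ e2
  rw [hx]
  linear_combination e2 + (-β) * e1 + β ^ 2 * e0

lemma one_mem_negBetaIntegers (h : 1 < β) (hg : β + 1 ≤ β ^ 2) : 1 ∈ negBetaIntegers β := by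
  have hl := mul_leftEnd h
  have hl0 := leftEnd_neg h
  have hl1 := neg_one_lt_leftEnd h
  have hb : β * (1 / β) = 1 := by field_simp
  have hb0 : 0 < 1 / β := by positivity
  rcases eq_or_lt_of_le hg with hg | hg
  -- For the golden ratio `1/β² = l + 1` is not allowed as initial residue, so `1 = β² - β` is
  -- written with digits `1 1 0`.
  · have hlb : leftEnd β = -(1 / β) := by nlinarith
    refine mem_negBetaIntegers_of_three_digits h 1 1 0 (y₀ := (1 / β - 1) * (1 / β))
      (y₁ := -(1 / β)) (y₂ := 0) ?_ ?_ (Set.Ioo_subset_Ico_self (zero_mem_Ioo h)) ?_ ?_ ?_ ?_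
    · constructor <;> nlinarith
    · constructor <;> linarith
    · push_cast; linear_combination (1 - 1 / β) * hb + 2 * (1 / β - 1) * hb
    · push_cast; linarith
    · simp
    · push_cast; linarith
  · refine mem_negBetaIntegers_of_two_digits h 0 1 (y₁ := (1 / β) * (1 / β)) (y₂ := -(1 / β))
      ?_ ?_ ?_ ?_ ?_
    · constructor
      · nlinarith
      · have : 1 / β * (1 / β) * β ^ 2 = 1 := by field_simp
        nlinarith
    · constructor <;> nlinarith
    · push_cast; linear_combination -(1 / β) * hb + 2 * (1 / β) * hb
    · push_cast; linarith
    · simp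

/-- The residue of such an `x` is `x` or `x - 1`. -/
lemma not_mem_of_mem_Ioo_zero_one (h : 1 < β) (hg : β + 1 ≤ β ^ 2) {x : ℝ}
    (hx0 : 0 < x) (hx1 : x < 1) : x ∉ negBetaIntegers β := by
  have hl := mul_leftEnd h
  have hl0 := leftEnd_neg h
  have hl1 := neg_one_lt_leftEnd h
  rw [mem_negBetaIntegers_iff h]
  intro hx
  by_cases hxl : x < leftEnd β + 1
  · have := hx.unique h (Residue.refl ⟨by linarith, hxl⟩)
    linarith
  · have h1 : Residue β x (x - 1) := by
      have hb : β * (x / -β) = -x := by field_simp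
      refine (Residue.refl (x := x / -β) ⟨?_, ?_⟩).step h 1 ⟨by linarith, by linarith⟩ ?_ ?_
      · nlinarith
      · nlinarith
      · linarith
      · push_cast; linarith
    have := hx.unique h h1
    linarith

section Gap

variable {r : ℤ}

/-- The digits are `1 r`; the last is admissible because `r ≤ β²/(β + 1) = -βl`. -/
lemma sub_mem_negBetaIntegers (h : 1 < β) (hr1 : 1 ≤ r) (hr : r * (β + 1) ≤ β ^ 2) :
    (r - β : ℝ) ∈ negBetaIntegers β := by
  have hl := mul_leftEnd h
  have hl0 := leftEnd_neg h
  have hl1 := neg_one_lt_leftEnd h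
  have hr1' : (1 : ℝ) ≤ r := by exact_mod_cast hr1
  have hb : β * (1 / β) = 1 := by field_simp
  have hb0 : 0 < 1 / β := by positivity
  have hb1 : 1 / β < 1 := by rw [div_lt_one] <;> linarith
  have e : (β + 1) * (leftEnd β * β) = - β ^ 2 := by nlinarith
  have hrl : (r : ℝ) ≤ -(leftEnd β * β) := by
    by_contra hlt
    nlinarith
  have hrb : r * (1 / β) ≤ -leftEnd β := by
    have : r * (1 / β) ≤ -(leftEnd β * β) * (1 / β) := by gcongr
    linarith [show leftEnd β * β * (1 / β) = leftEnd β by linear_combination leftEnd β * hb]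
  have hrb0 : 0 < r * (1 / β) := by positivity
  refine mem_negBetaIntegers_of_two_digits h 1 r (y₁ := (r * (1 / β) - 1) * (1 / β))
    (y₂ := -(r * (1 / β))) ?_ ?_ ?_ ?_ ?_
  · constructor
    · have h1 : leftEnd β * β < 1 / β - 1 := by nlinarith
      have h2 : 1 / β ≤ r * (1 / β) := by nlinarith
      have h3 : leftEnd β = leftEnd β * β * (1 / β) := by linear_combination -leftEnd β * hb
      rw [h3]
      gcongr
      linarith
    · nlinarith
  · constructor <;> linarith
  · push_cast; linear_combination (r * (1 / β) - 1) * hb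
  · linear_combination -(r : ℝ) * hb
  · push_cast; ring

/-- Points above `l` are their own residue. A point `x ≤ l` would have digits `1 d`, so `x = d - β`
with `r < d ≤ l + β = β²/(β + 1) < r + 1`. -/
lemma not_mem_of_mem_Ioo_sub_zero (h : 1 < β) (hr1 : 1 ≤ r)
    (hr' : β ^ 2 < (r + 1) * (β + 1)) {x : ℝ} (hx0 : r - β < x) (hx1 : x < 0) :
    x ∉ negBetaIntegers β := by
  have hl := mul_leftEnd h
  have hl0 := leftEnd_neg h
  have hl1 := neg_one_lt_leftEnd h
  have hr1' : (1 : ℝ) ≤ r := by exact_mod_cast hr1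
  rw [mem_negBetaIntegers_iff h]
  intro hx
  by_cases hxl : leftEnd β < x
  · have := hx.unique h (Residue.refl ⟨hxl, by linarith⟩)
    linarith
  · push Not at hxl
    set w := x / (-β) ^ 2 with hw
    have hwx : β * (β * w) = x := by rw [hw]; field_simp
    have hw0 : w < 0 := by
      by_contra hlt
      push Not at hlt
      have : 0 ≤ β * (β * w) := by positivity
      linarith
    have hwl : β * w ≥ -1 := by
      by_contra hlt
      nlinarith
    have hwl2 : leftEnd β < w := by
      by_contra hlt
      nlinarith
    have hlw : leftEnd β + 1 ≤ - (β * w) := by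
      by_contra hlt
      nlinarith
    have h1 : Residue β (-β * w) (-β * w - 1) :=
      (Residue.refl (x := w) ⟨hwl2, by linarith⟩).step h 1
        ⟨by linarith, by linarith⟩ rfl (by push_cast; ring)
    have h2 := h1.map_T h
    rw [show -β * (-β * w) = x by linarith] at h2
    have h3 := hx.unique h h2
    rw [T] at h3
    set d := ⌊-β * (-β * w - 1) - leftEnd β⌋
    have h4 : (d : ℝ) = x + β := by linarith
    have h5 : (r : ℝ) < d := by linarith
    have h6 : (d : ℝ) < r + 1 := by
      have : (x + β) * (β + 1) ≤ β ^ 2 := by nlinarith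
      by_contra hlt
      push Not at hlt
      rw [h4] at hlt
      nlinarith
    have h5' : r < d := by exact_mod_cast h5
    have h6' : d < r + 1 := by exact_mod_cast h6
    omega

end Gap

lemma mem_negBetaIntegers_of_int_base (h : 1 < β) {n : ℤ} (hn : β = n) {x : ℝ} :
    x ∈ negBetaIntegers β ↔ ∃ k : ℤ, x = k := by
  rw [mem_negBetaIntegers_iff h]
  have hq : β ^ 2 = (n : ℤ) * β + (0 : ℤ) := by rw [hn]; push_cast; ring
  have key : ∀ x y, Residue β x y → ∃ k : ℤ, x = y + k := by
    intro x y hxy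
    obtain ⟨a, c, e, -⟩ := Residue.induction hq (Inv := fun _ _ => True)
      (fun _ _ => trivial) (fun _ _ _ _ _ _ _ _ => trivial) h hxy
    exact ⟨a + c * n, by rw [e, hn]; push_cast; ring⟩
  constructor
  · intro hx
    obtain ⟨k, hk⟩ := key _ _ hx
    exact ⟨k, by linarith⟩
  · rintro ⟨k, rfl⟩
    obtain ⟨y, hy⟩ := Residue.exists h k
    obtain ⟨k', hk'⟩ := key _ _ hy
    have hm := hy.mem
    have e : y = ((k - k' : ℤ) : ℝ) := by push_cast; linarith
    have h1 : (((k - k' : ℤ) : ℝ)) < 1 := by rw [← e]; linarith [hm.2, leftEnd_neg h]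
    have h2 : (-1 : ℝ) < ((k - k' : ℤ) : ℝ) := by
      rw [← e]; linarith [hm.1, neg_one_lt_leftEnd h]
    have h1' : k - k' < 1 := by exact_mod_cast h1
    have h2' : -1 < k - k' := by exact_mod_cast h2
    have : k - k' = 0 := by omega
    rw [this] at e
    push_cast at e
    rwa [e] at hy

/-! ### Slopes and bounded conjugates -/

/-- A counting function all of whose increments over equal lengths differ by at most one has a
slope `α`, with deviation at most one. -/
lemma exists_slope {P : ℤ → ℤ}
    (hP : ∀ (i i' : ℤ) (n : ℕ), |(P (i + n) - P i) - (P (i' + n) - P i')| ≤ 1) :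
    ∃ α : ℝ, ∀ i j : ℤ, |((P i - P j : ℤ) : ℝ) - α * ((i - j : ℤ) : ℝ)| ≤ 1 := by
  have hlow : ∀ (i : ℤ) (n k : ℕ), k * (P (i + n) - P i - 1) ≤ P (k * n) - P 0 := by
    intro i n k
    induction k with
    | zero => simp
    | succ k ih =>
      have := abs_le.mp (hP i (k * n) n)
      push_cast
      rw [add_one_mul, add_one_mul]
      linarith
  have hupp : ∀ (i : ℤ) (n k : ℕ), P (k * n) - P 0 ≤ k * (P (i + n) - P i + 1) := by
    intro i n k
    induction k with
    | zero => simp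
    | succ k ih =>
      have := abs_le.mp (hP i (k * n) n)
      push_cast
      rw [add_one_mul, add_one_mul]
      linarith
  -- A block of length `n n'` is cut into pieces of length `n` and into pieces of length `n'`. The
  -- slope is then the supremum of the lower estimates.
  have hcmp : ∀ (i i' : ℤ) (n n' : ℕ), 0 < n → 0 < n' →
      ((P (i + n) - P i - 1 : ℤ) : ℝ) / n ≤ ((P (i' + n') - P i' + 1 : ℤ) : ℝ) / n' := by
    intro i i' n n' hn hn'
    have h1 := hlow i n n'
    have h2 := hupp i' n' n
    rw [mul_comm (n : ℤ) n'] at h2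
    rw [div_le_div_iff₀ (by exact_mod_cast hn) (by exact_mod_cast hn')]
    have := h1.trans h2
    rw [mul_comm, mul_comm (((P (i' + n') - P i' + 1 : ℤ) : ℝ))]
    exact_mod_cast this
  set S : Set ℝ := {x | ∃ (i : ℤ) (n : ℕ), 0 < n ∧ x = ((P (i + n) - P i - 1 : ℤ) : ℝ) / n}
  have hne : S.Nonempty := ⟨_, 0, 1, one_pos, rfl⟩
  have hbdd : BddAbove S := by
    refine ⟨((P (0 + (1 : ℕ)) - P 0 + 1 : ℤ) : ℝ) / (1 : ℕ), ?_⟩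
    rintro x ⟨i, n, hn, rfl⟩
    exact hcmp i 0 n 1 hn one_pos
  have hα : ∀ (i : ℤ) (n : ℕ), |((P (i + n) - P i : ℤ) : ℝ) - sSup S * n| ≤ 1 := by
    intro i n
    rcases Nat.eq_zero_or_pos n with rfl | hn
    · simp
    · have hn' : (0 : ℝ) < n := by exact_mod_cast hn
      have h1 : ((P (i + n) - P i - 1 : ℤ) : ℝ) / n ≤ sSup S := le_csSup hbdd ⟨i, n, hn, rfl⟩
      have h2 : sSup S ≤ ((P (i + n) - P i + 1 : ℤ) : ℝ) / n := by
        apply csSup_le hne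
        rintro x ⟨i', n', hn', rfl⟩
        exact hcmp i' i n' n hn' hn
      rw [div_le_iff₀ hn'] at h1
      rw [le_div_iff₀ hn'] at h2
      rw [abs_le]
      push_cast at *
      constructor <;> linarith
  refine ⟨sSup S, fun i j => ?_⟩
  rcases le_total j i with hij | hij
  · obtain ⟨n, hn⟩ := Int.eq_ofNat_of_zero_le (sub_nonneg.mpr hij)
    have := hα j n
    rw [← hn, add_sub_cancel] at this
    rw [hn]
    exact this
  · obtain ⟨n, hn⟩ := Int.eq_ofNat_of_zero_le (sub_nonneg.mpr hij)
    have := hα i n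
    rw [← hn, add_sub_cancel] at this
    rw [← neg_sub j i, hn, ← abs_neg]
    push_cast at *
    convert this using 2
    ring

lemma IsBalanced.exists_slope {A : Type*} {u : ℤ → A} (hu : IsBalanced u) {a : A} {P : ℤ → ℤ}
    (hQ : ∀ j, (u j = a → P (j + 1) - P j = 1) ∧ (u j ≠ a → P (j + 1) - P j = 0)) :
    ∃ α : ℝ, ∀ i j : ℤ, |((P i - P j : ℤ) : ℝ) - α * ((i - j : ℤ) : ℝ)| ≤ 1 := by
  classical
  apply NegBeta.exists_slope
  intro i i' n
  have hQ' : ∀ j, P (j + 1) - P j = if u j = a then 1 else 0 := by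
    intro j
    split_ifs with h
    · exact (hQ j).1 h
    · exact (hQ j).2 h
  have := hu ((List.range n).map fun j : ℕ => u (i + j)) ((List.range n).map fun j : ℕ => u (i' + j))
    ⟨i, by simp⟩ ⟨i', by simp⟩ (by simp) a
  rw [count_factor hQ', count_factor hQ'] at this
  exact this

/-- An enumeration `j + P j * δ` of a `(-β)`-invariant set by a function `P` with bounded
deviation: the conjugates `j - κ * P j` fill an interval of length at most `|κ|`. -/
lemma conjugate_bound (h : 1 < β) {β' δ κ α : ℝ} (hne : β ≠ β') {P : ℤ → ℤ} (hP0 : P 0 = 0)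
    (hP : ∀ i j : ℤ, |((P i - P j : ℤ) : ℝ) - α * ((i - j : ℤ) : ℝ)| ≤ 1)
    (hmul : ∀ j : ℤ, ∃ i : ℤ, (i + P i * δ : ℝ) = -β * (j + P j * δ) ∧
      (i - κ * P i : ℝ) = -β' * (j - κ * P j))
    (hunb : ∃ j : ℤ, (j + P j * δ : ℝ) ≠ 0) :
    ∀ i j : ℤ, |((i - κ * P i) - (j - κ * P j) : ℝ)| ≤ |κ| := by
  have he : ∀ j : ℤ, |(P j : ℝ) - α * j| ≤ 1 := by
    intro j
    simpa [hP0] using hP j 0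
  set c := 1 - α * κ with hc
  set μ := 1 + α * δ with hμ
  -- If `μ = 0`, all points are bounded by `|δ|`, although multiplication by `-β` blows up a nonzero
  -- one.
  have hμ0 : μ ≠ 0 := by
    intro hμ0
    obtain ⟨j, hj⟩ := hunb
    have hb : ∀ i : ℤ, |(i + P i * δ : ℝ)| ≤ |δ| := by
      intro i
      have : (i + P i * δ : ℝ) = δ * (P i - α * i) := by
        linear_combination (i : ℝ) * hμ0 - (i : ℝ) * hμ
      rw [this, abs_mul]
      exact mul_le_of_le_one_right (abs_nonneg _) (he i)
    have hk : ∀ k : ℕ, ∃ i : ℤ, (i + P i * δ : ℝ) = (-β) ^ k * (j + P j * δ) := by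
      intro k
      induction k with
      | zero => exact ⟨j, by simp⟩
      | succ k ih =>
        obtain ⟨i, hi⟩ := ih
        obtain ⟨i', hi', -⟩ := hmul i
        exact ⟨i', by rw [hi', hi]; ring⟩
    have hpos := abs_pos.mpr hj
    obtain ⟨k, hk'⟩ := pow_unbounded_of_one_lt (|δ| / |(j + P j * δ : ℝ)|) h
    obtain ⟨i, hi⟩ := hk k
    have := hb i
    rw [hi, abs_mul, abs_pow, abs_neg, abs_of_pos (by linarith : 0 < β)] at this
    rw [div_lt_iff₀ hpos] at hk'
    linarith
  -- Points `x` grow like `μj` and conjugates `x'` like `cj`, so `cx - μx'` is bounded. Comparing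
  -- this at `x` and at `-βx` bounds `μ(β - β')x'`, hence `x'`, which contradicts growth if `c ≠ 0`.
  have hc0 : c = 0 := by
    by_contra hc0
    have hG : ∀ j : ℤ, |c * (j + P j * δ) - μ * (j - κ * P j)| ≤ |c * δ + μ * κ| := by
      intro j
      have : c * (j + P j * δ) - μ * (j - κ * P j) = (c * δ + μ * κ) * (P j - α * j) := by
        rw [hc, hμ]; ring
      rw [this, abs_mul]
      exact mul_le_of_le_one_right (abs_nonneg _) (he j)
    set K := |c * δ + μ * κ|
    have hF : ∀ j : ℤ, |μ * (β - β') * (j - κ * P j)| ≤ K + β * K := by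
      intro j
      obtain ⟨i, h1, h2⟩ := hmul j
      have hi := hG i
      rw [h1, h2] at hi
      have : -(μ * (β - β') * (j - κ * P j)) =
          (c * (-β * (j + P j * δ)) - μ * (-β' * (j - κ * P j))) +
            β * (c * (j + P j * δ) - μ * (j - κ * P j)) := by ring
      rw [← abs_neg, this]
      refine (abs_add_le _ _).trans (add_le_add hi ?_)
      rw [abs_mul, abs_of_pos (by linarith : 0 < β)]
      exact mul_le_mul_of_nonneg_left (hG j) (by linarith)
    have hm : 0 < |μ * (β - β')| := abs_pos.mpr (mul_ne_zero hμ0 (sub_ne_zero.mpr hne))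
    have hcpos := abs_pos.mpr hc0
    obtain ⟨n, hn⟩ := exists_nat_gt (((K + β * K) / |μ * (β - β')| + |κ|) / |c|)
    have h1 := hF n
    rw [abs_mul, mul_comm, ← le_div_iff₀ hm] at h1
    rw [div_lt_iff₀ hcpos] at hn
    have h2 : |c| * n ≤ |((n : ℤ) - κ * P n : ℝ)| + |κ| := by
      have e : c * n = ((n : ℤ) - κ * P n : ℝ) + κ * (P n - α * (n : ℤ)) := by
        rw [hc]; push_cast; ring
      have : |c| * n = |c * n| := by rw [abs_mul, Nat.abs_cast]
      rw [this, e]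
      refine (abs_add_le _ _).trans (add_le_add le_rfl ?_)
      rw [abs_mul]
      exact mul_le_of_le_one_right (abs_nonneg _) (he n)
    linarith
  intro i j
  have e : ((i - κ * P i) - (j - κ * P j) : ℝ) =
      -(κ * (((P i - P j : ℤ) : ℝ) - α * ((i - j : ℤ) : ℝ))) := by
    push_cast
    linear_combination ((i : ℝ) - j) * (hc0 - hc)
  rw [e, abs_neg, abs_mul]
  exact mul_le_of_le_one_right (abs_nonneg _) (hP i j)

lemma irrational_of_quadratic (hint : ∀ n : ℤ, β ≠ n) {A B : ℤ} (hq : β ^ 2 = A * β + B) :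
    Irrational β := by
  rintro ⟨x, rfl⟩
  have hx : x ^ 2 = A * x + B := by exact_mod_cast hq
  have hi : IsIntegral ℤ x := by
    refine ⟨X ^ 2 + (C (-A) * X + C (-B)), monic_X_pow_add ?_, ?_⟩
    · exact lt_of_le_of_lt degree_linear_le (by norm_num)
    · rw [← aeval_def]
      simp
      linarith
  obtain ⟨n, hn⟩ := IsIntegrallyClosed.isIntegral_iff.mp hi
  apply hint n
  rw [← hn]
  simp

/-! ### Gaps at `0` and test points -/

/-- The gaps to the right and to the left of `0` in `ℤ_{-β}`. -/
lemma gaps_at_zero (h : 1 < β) (hg : β + 1 ≤ β ^ 2) {r : ℤ} (hr1 : 1 ≤ r)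
    (hr : r * (β + 1) ≤ β ^ 2) (hr' : β ^ 2 < (r + 1) * (β + 1)) {t : ℤ → ℝ}
    (ht : StrictMono t) (h0 : t 0 = 0) (hrange : Set.range t = negBetaIntegers β) :
    t 1 = 1 ∧ t (-1) = r - β := by
  have hmem : ∀ j, t j ∈ negBetaIntegers β := fun j => hrange ▸ ⟨j, rfl⟩
  have hrβ : r - β < 0 := by nlinarith
  constructor
  · obtain ⟨i, hi⟩ : (1 : ℝ) ∈ Set.range t := hrange ▸ one_mem_negBetaIntegers h hg
    have h1 : 0 < i := ht.lt_iff_lt.mp (by rw [h0, hi]; exact one_pos)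
    have h2 : t 1 ≤ 1 := by rw [← hi]; exact ht.monotone (by omega)
    have h3 : 0 < t 1 := by rw [← h0]; exact ht one_pos
    by_contra hne
    exact not_mem_of_mem_Ioo_zero_one h hg h3 (lt_of_le_of_ne h2 hne) (hmem 1)
  · obtain ⟨i, hi⟩ : (r - β : ℝ) ∈ Set.range t := hrange ▸ sub_mem_negBetaIntegers h hr1 hr
    have h1 : i < 0 := ht.lt_iff_lt.mp (by rw [h0, hi]; exact hrβ)
    have h2 : r - β ≤ t (-1) := by rw [← hi]; exact ht.monotone (by omega)
    have h3 : t (-1) < 0 := by rw [← h0]; exact ht (by omega)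
    by_contra hne
    exact not_mem_of_mem_Ioo_sub_zero h hr1 hr' (lt_of_le_of_ne h2 (Ne.symm hne)) h3 (hmem _)

/-- A test point for `A = B`: for `β' < 0` all terms of its conjugate are positive. Its last residue
is exactly `l`. -/
lemma mem_negBetaIntegers_of_eq (h : 1 < β) {B : ℤ} (hB : B * (β + 1) = β ^ 2) :
    (B * β ^ 2 - B * β + B : ℝ) ∈ negBetaIntegers β := by
  have hl := mul_leftEnd h
  have hl0 := leftEnd_neg h
  have hl1 := neg_one_lt_leftEnd h
  have hib : β * (1 / β) = 1 := by field_simp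
  have hib0 : 0 < 1 / β := by positivity
  have hib1 : 1 / β < 1 := by rw [div_lt_one] <;> linarith
  have hlB : (B : ℝ) = -(leftEnd β * β) := by
    have : (β + 1) * (B + leftEnd β * β) = 0 := by linear_combination hB + β * hl
    rcases mul_eq_zero.mp this with h1 | h1 <;> linarith
  have hy1 : leftEnd β * (1 - 1 / β) < 0 := mul_neg_of_neg_of_pos hl0 (by linarith)
  have hy1' : leftEnd β ≤ leftEnd β * (1 - 1 / β) := by nlinarith
  have hy0 : leftEnd β * (1 - 1 / β) * (1 / β) < 0 := mul_neg_of_neg_of_pos hy1 hib0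
  have hy0' : -1 < leftEnd β * (1 - 1 / β) * (1 / β) := by nlinarith
  exact mem_negBetaIntegers_of_three_digits h B B B
    (y₀ := leftEnd β - leftEnd β * (1 - 1 / β) * (1 / β))
    (y₁ := leftEnd β * (1 - 1 / β)) (y₂ := leftEnd β)
    ⟨by linarith, by linarith⟩ ⟨hy1', by linarith⟩ ⟨le_rfl, by linarith⟩
    (by rw [hlB]; linear_combination -(leftEnd β * (1 - 1 / β)) * hib)
    (by rw [hlB]; linear_combination -leftEnd β * hib)
    (by rw [hlB]; ring) rfl

/-- The analogous test point for `B < A`. Since `β²/(β + 1) < A`, the last digit cannot be `A`. -/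
lemma mem_negBetaIntegers_of_lt (h : 1 < β) {A B : ℤ} (hq : β ^ 2 = A * β + B) (hAβ : A < β)
    (hB : 1 ≤ B) (hBA : B < A) :
    ((A - 1) * β ^ 2 - A * β + (A - 1) : ℝ) ∈ negBetaIntegers β := by
  have hB' : (1 : ℝ) ≤ B := by exact_mod_cast hB
  have hBA' : (B : ℝ) + 1 ≤ A := by exact_mod_cast hBA
  have hl := mul_leftEnd h
  have hl0 := leftEnd_neg h
  have hl1 := neg_one_lt_leftEnd h
  obtain ⟨b, hib⟩ : ∃ b, β * b = 1 := ⟨1 / β, by field_simp⟩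
  have hib0 : 0 < b := by
    by_contra hlt
    nlinarith
  have e : (β + 1) * (leftEnd β * β) = - β ^ 2 := by nlinarith
  have hlA : (A : ℝ) - 1 < -(leftEnd β * β) := by
    have : (β + 1) * ((A : ℝ) - 1) < (β + 1) * -(leftEnd β * β) := by linarith
    exact lt_of_mul_lt_mul_left this (by linarith)
  have hlb : leftEnd β * β * b = leftEnd β := by linear_combination leftEnd β * hib
  have hy2 : ((A : ℝ) - 1) * b < -leftEnd β := by
    have := mul_lt_mul_of_pos_right hlA hib0
    linarith
  have hy2' : 0 < ((A : ℝ) - 1) * b := mul_pos (by linarith) hib0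
  have hy1 : ((A - 1) * b - A) * b < 0 := mul_neg_of_neg_of_pos (by linarith) hib0
  have hy1' : leftEnd β ≤ ((A - 1) * b - A) * b := by
    have h1 : (A - 1 - A * β) * (β + 1) ≥ leftEnd β * (β ^ 2 * (β + 1)) := by
      have : leftEnd β * (β ^ 2 * (β + 1)) = -β * (A * β + B) := by
        rw [← hq]; linear_combination β * e
      rw [this]
      nlinarith
    have h2 : ((A - 1) * b - A) * b * (β ^ 2 * (β + 1)) = (A - 1 - A * β) * (β + 1) := by
      linear_combination ((A - 1) * (β * b + 1) - A * β) * (β + 1) * hib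
    rw [← h2] at h1
    exact le_of_mul_le_mul_right h1 (by positivity)
  have hy0 : leftEnd β < -(((A - 1) * b - A) * b + (A - 1)) * b := by
    rw [← hlb]
    apply mul_lt_mul_of_pos_right _ hib0
    linarith
  have hy0' : -(((A - 1) * b - A) * b + (A - 1)) * b < 0 :=
    mul_neg_of_neg_of_pos (by linarith) hib0
  refine mem_negBetaIntegers_of_three_digits h (A - 1) A (A - 1)
    (y₀ := -(((A - 1) * b - A) * b + (A - 1)) * b)
    (y₁ := ((A - 1) * b - A) * b) (y₂ := -((A - 1) * b))
    ⟨hy0, by linarith⟩ ⟨hy1', by linarith⟩ ⟨by linarith, by linarith⟩ ?_ ?_ ?_ ?_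
  · push_cast; linear_combination -(((A - 1) * b - A) * b + (A - 1)) * hib
  · linear_combination ((A - 1) * b - A) * hib
  · push_cast; linear_combination -((A : ℝ) - 1) * hib
  · push_cast; ring

lemma int_mem_negBetaIntegers (h : 1 < β) {r : ℤ} (hr1 : 1 ≤ r) (hr : r * (β + 1) < β ^ 2) :
    (r : ℝ) ∈ negBetaIntegers β := by
  have hl := mul_leftEnd h
  have hl0 := leftEnd_neg h
  have hl1 := neg_one_lt_leftEnd h
  have hr1' : (1 : ℝ) ≤ r := by exact_mod_cast hr1
  obtain ⟨b, hib⟩ : ∃ b, β * b = 1 := ⟨1 / β, by field_simp⟩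
  have hib0 : 0 < b := by
    by_contra hlt
    nlinarith
  have e : (β + 1) * (leftEnd β * β) = - β ^ 2 := by nlinarith
  have hlr : (r : ℝ) < -(leftEnd β * β) := by
    have : (β + 1) * (r : ℝ) < (β + 1) * -(leftEnd β * β) := by linarith
    exact lt_of_mul_lt_mul_left this (by linarith)
  have hlb : leftEnd β * β * b = leftEnd β := by linear_combination leftEnd β * hib
  have hy2 : r * b < -leftEnd β := by
    have := mul_lt_mul_of_pos_right hlr hib0
    linarith
  have hy2' : 0 < r * b := mul_pos (by linarith) hib0
  have hy1 : r * b * b < leftEnd β + 1 := by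
    have h1 : -leftEnd β * b = leftEnd β + 1 := by linear_combination -b * hl + (1 + leftEnd β) * hib
    rw [← h1]
    exact mul_lt_mul_of_pos_right hy2 hib0
  have hy1' : 0 < r * b * b := mul_pos hy2' hib0
  refine mem_negBetaIntegers_of_two_digits h 0 r (y₁ := r * b * b) (y₂ := -(r * b))
    ⟨by linarith, hy1⟩ ⟨by linarith, by linarith⟩ ?_ ?_ ?_
  · push_cast; linear_combination r * b * hib
  · linear_combination -(r : ℝ) * hib
  · push_cast; ring

section Unit

variable {A B r : ℤ}

/-- The conjugates `r` and `-rβ'` of `r` and `-rβ` give `(r + 1)β' ≤ 1`. With `ββ' = -B` and `β² <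
(r + 1)(β + 1)` this yields `-Bβ < β + 1 < 2β`. -/
lemma int_unit_of_conjugate_pos (h : 1 < β) (hirr : Irrational β)
    (hq : β ^ 2 = A * β + B) (hpos : 0 < A - β) (hr1 : 1 ≤ r)
    (hr : r * (β + 1) ≤ β ^ 2) (hr' : β ^ 2 < (r + 1) * (β + 1))
    (hb : ∀ a c : ℤ, (a + c * β : ℝ) ∈ negBetaIntegers β → ∀ a' c' : ℤ,
      (a' + c' * β : ℝ) ∈ negBetaIntegers β →
      (a + c * (A - β) : ℝ) - (a' + c' * (A - β)) ≤ r + 1 - (A - β)) :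
    B = -1 := by
  have hN : β * (A - β) = -B := by linarith
  have hB0 : (B : ℝ) < 0 := by nlinarith
  have hB0' : B < 0 := by exact_mod_cast hB0
  have hlt : r * (β + 1) < β ^ 2 := by
    refine lt_of_le_of_ne hr fun hEq => ?_
    have := int_combination_eq_zero hirr (a := B - r) (c := A - r) (by push_cast; linarith)
    omega
  have hmem := int_mem_negBetaIntegers h hr1 hlt
  have hbd := hb r 0 (by simpa using hmem) 0 (-r)
    (by convert neg_mul_mem_negBetaIntegers h hmem using 1; push_cast; ring)
  push_cast at hbd
  by_contra hB
  have hB2 : (B : ℝ) ≤ -2 := by exact_mod_cast (by omega : B ≤ -2)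
  have h1 : β ^ 2 * (A - β) < (r + 1) * (β + 1) * (A - β) := mul_lt_mul_of_pos_right hr' hpos
  have h2 : (r + 1) * (A - β) * (β + 1) ≤ 1 * (β + 1) :=
    mul_le_mul_of_nonneg_right (by linarith) (by linarith)
  have h3 : β ^ 2 * (A - β) = β * -B := by rw [← hN]; ring
  nlinarith

lemma int_unit_of_conjugate_neg (h : 1 < β)
    (hq : β ^ 2 = A * β + B) (hneg : A - β < 0) (hβ' : -1 < A - β)
    (hr : r * (β + 1) ≤ β ^ 2)
    (hb : ∀ a c : ℤ, (a + c * β : ℝ) ∈ negBetaIntegers β → ∀ a' c' : ℤ,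
      (a' + c' * β : ℝ) ∈ negBetaIntegers β →
      (a + c * (A - β) : ℝ) - (a' + c' * (A - β)) ≤ r + 1 - (A - β)) :
    B = 1 := by
  have h0mem : ((0 : ℤ) + (0 : ℤ) * β : ℝ) ∈ negBetaIntegers β := by
    rw [mem_negBetaIntegers_iff h]
    simpa using Residue.refl (zero_mem_Ioo h)
  have hN : β * (β - A) = B := by linarith
  have hq' : (A - β) ^ 2 = A * (A - β) + B := by linarith
  have hB0 : (0 : ℝ) < B := by rw [← hN]; apply mul_pos <;> linarith
  have hB0' : 0 < B := by exact_mod_cast hB0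
  by_contra hB
  have hB2 : (2 : ℝ) ≤ B := by exact_mod_cast (by omega : 2 ≤ B)
  have hBβ : (B : ℝ) < β := by nlinarith
  have hBA : (B : ℝ) < A + 1 := by linarith
  have hBA' : B < A + 1 := by exact_mod_cast hBA
  have hβ1 : 0 < β + 1 := by linarith
  -- Each test point is compared with `0`. For `A = B` this gives `B|β'| ≤ 1`, so `B² ≤ β < B + 1`.
  -- For `B < A` it gives `(A - 1)(β'² + |β'|) ≤ 1`, so `2(A - 1)β ≤ β² < (A + 1)β`, although `A ≥
  -- 3`.
  rcases eq_or_lt_of_le (by omega : B ≤ A) with hEq | hLt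
  · subst hEq
    have hEq : B * (β + 1) = β ^ 2 := by linarith
    have hrB : (r : ℝ) ≤ B := le_of_mul_le_mul_right (by linarith) hβ1
    have hbd := hb (B * B + B) (B * B - B)
      (by
        convert mem_negBetaIntegers_of_eq h hEq using 1
        push_cast; linear_combination (-B : ℝ) * hq) 0 0 h0mem
    push_cast at hbd
    have h1 : (B : ℝ) * (β - B) * (1 + (β - B)) ≤ 1 * (1 + (β - B)) := by nlinarith
    have h2 : (B : ℝ) * (β - B) ≤ 1 := le_of_mul_le_mul_right h1 (by linarith)
    have h3 : β * ((B : ℝ) * (β - B)) ≤ β * 1 := mul_le_mul_of_nonneg_left h2 (by linarith)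
    have h4 : β * ((B : ℝ) * (β - B)) = B * B := by linear_combination (B : ℝ) * hN
    nlinarith
  · have hAB : (B : ℝ) + 1 ≤ A := by exact_mod_cast hLt
    have hrA : (r : ℝ) ≤ A - 1 := by
      have h1 : (r : ℝ) < A := lt_of_mul_lt_mul_right (by linarith) hβ1.le
      have h1' : r < A := by exact_mod_cast h1
      exact_mod_cast (by omega : r ≤ A - 1)
    have hbd := hb ((A - 1) * B + A - 1) ((A - 1) * A - A)
      (by
        convert mem_negBetaIntegers_of_lt h hq (by linarith) (by omega) hLt using 1
        push_cast; linear_combination (1 - A : ℝ) * hq) 0 0 h0mem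
    push_cast at hbd
    have h1 : ((A : ℝ) - 1) * ((β - A) ^ 2 + (β - A)) ≤ 1 := by
      linarith [show ((A : ℝ) - 1) * (β - A) ^ 2 = (A - 1) * (A * (A - β) + B) by
        rw [← hq']; ring]
    have h2 : β ^ 2 * (((A : ℝ) - 1) * ((β - A) ^ 2 + (β - A))) ≤ β ^ 2 * 1 :=
      mul_le_mul_of_nonneg_left h1 (by positivity)
    have h3 : β ^ 2 * (((A : ℝ) - 1) * ((β - A) ^ 2 + (β - A))) =
        (A - 1) * (B ^ 2 + β * B) := by rw [← hN]; ring
    have h4 : ((A : ℝ) - 1) * (2 * β) ≤ (A - 1) * (B ^ 2 + β * B) := by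
      apply mul_le_mul_of_nonneg_left _ (by linarith)
      nlinarith
    have h5 : β * β < β * (A + 1) := by gcongr; linarith
    have h6 : β * (A + 1) ≤ β * (2 * (A - 1)) := by gcongr; linarith
    linarith

end Unit

/-! ### From Sturmian codings to quadratic Pisot units -/

/-- A Sturmian coding of `ℤ_{-β}` forces `β` to be a quadratic Pisot unit. -/
lemma isQuadraticPisotUnit_of_sturmian (h : 1 < β) {X : Type*} {u : ℤ → X}
    (hu : IsCodingWord β u) (hs : IsSturmian u) : IsQuadraticPisotUnit β := by
  obtain ⟨t, Δ, ht, h0, hrange, hΔ, hgap⟩ := hu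
  obtain ⟨hcard, -, hbal⟩ := hs
  have hmem : ∀ j, t j ∈ negBetaIntegers β := fun j => hrange ▸ ⟨j, rfl⟩
  have hg : β + 1 ≤ β ^ 2 := by
    by_contra hg
    push Not at hg
    have h1 := eq_zero_of_lt_golden h hg (hmem 1)
    have : t 0 < t 1 := ht one_pos
    linarith
  have hβ1 : 0 < β + 1 := by linarith
  obtain ⟨r, hr, hr'⟩ : ∃ r : ℤ, r * (β + 1) ≤ β ^ 2 ∧ β ^ 2 < (r + 1) * (β + 1) := by
    refine ⟨⌊β ^ 2 / (β + 1)⌋, ?_, ?_⟩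
    · rw [← le_div_iff₀ hβ1]; exact Int.floor_le _
    · rw [← div_lt_iff₀ hβ1]; exact Int.lt_floor_add_one _
  have hr1 : 1 ≤ r := by
    have : (0 : ℝ) < r := by
      by_contra hlt
      nlinarith
    have : 0 < r := by exact_mod_cast this
    omega
  obtain ⟨ht1, htm1⟩ := gaps_at_zero h hg hr1 hr hr' ht h0 hrange
  have hΔ0 : Δ (u 0) = 1 := by rw [← hgap, zero_add, ht1, h0, sub_zero]
  have hΔ1 : Δ (u (-1)) = β - r := by
    rw [← hgap, neg_add_cancel, htm1, h0]; ring
  have hint : ∀ n : ℤ, β ≠ n := by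
    intro n hn
    have hall : ∀ j, u j = u 0 := by
      intro j
      apply hΔ
      rw [← hgap, hΔ0]
      obtain ⟨k, hk⟩ := (mem_negBetaIntegers_of_int_base h hn).mp (hmem j)
      obtain ⟨k', hk'⟩ := (mem_negBetaIntegers_of_int_base h hn).mp (hmem (j + 1))
      obtain ⟨i, hi⟩ : ((k + 1 : ℤ) : ℝ) ∈ Set.range t := by
        rw [hrange]
        exact (mem_negBetaIntegers_of_int_base h hn).mpr ⟨k + 1, rfl⟩
      have h1 : j < i := ht.lt_iff_lt.mp (by rw [hk, hi]; push_cast; linarith)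
      have h2 : t (j + 1) ≤ t i := ht.monotone (by omega)
      have h3 : t j < t (j + 1) := ht (by omega)
      rw [hk', hi] at h2
      rw [hk, hk'] at h3
      have h2' : k' ≤ k + 1 := by exact_mod_cast h2
      have h3' : k < k' := by exact_mod_cast h3
      have : k' = k + 1 := by omega
      rw [hk, hk', this]
      push_cast; ring
    have : Set.range u = {u 0} := by
      ext x
      constructor
      · rintro ⟨j, rfl⟩; exact hall j
      · rintro rfl; exact ⟨0, rfl⟩
    rw [this, Set.ncard_singleton] at hcard
    omega
  set δ := β - r - 1 with hδ
  have hδ0 : δ ≠ 0 := fun e => hint (r + 1) (by push_cast; linarith)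
  have hne : u 0 ≠ u (-1) := fun e => hδ0 (by rw [← e, hΔ0] at hΔ1; linarith)
  have htwo : ∀ j, u j = u 0 ∨ u j = u (-1) := by
    intro j
    by_contra hcon
    push Not at hcon
    have hsub : ({u j, u 0, u (-1)} : Set X) ⊆ Set.range u := by
      rintro x (rfl | rfl | rfl) <;> exact ⟨_, rfl⟩
    have h3 : ({u j, u 0, u (-1)} : Set X).ncard = 3 :=
      Set.ncard_eq_three.mpr ⟨_, _, _, hcon.1, hcon.2, hne, rfl⟩
    have := Set.ncard_le_ncard hsub (Set.finite_of_ncard_ne_zero (by omega))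
    omega
  have hgap0 : ∀ j, u j = u 0 → t (j + 1) = t j + 1 := fun j hj => by
    have := hgap j
    rw [hj, hΔ0] at this
    linarith
  have hgap1 : ∀ j, u j = u (-1) → t (j + 1) = t j + 1 + δ := fun j hj => by
    have := hgap j
    rw [hj, hΔ1] at this
    linarith
  have hP : ∀ j : ℤ, ∃ p : ℤ, t j = j + p * δ := by
    intro j
    induction j using Int.induction_on with
    | zero => exact ⟨0, by simp [h0]⟩
    | succ i ih =>
      obtain ⟨p, hp⟩ := ih
      rcases htwo i with hj | hj
      · exact ⟨p, by rw [hgap0 _ hj, hp]; push_cast; ring⟩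
      · exact ⟨p + 1, by rw [hgap1 _ hj, hp]; push_cast; ring⟩
    | pred i ih =>
      obtain ⟨p, hp⟩ := ih
      rcases htwo (-i - 1) with hj | hj
      · have := hgap0 _ hj
        rw [sub_add_cancel, hp] at this
        exact ⟨p, by push_cast at *; linarith⟩
      · have := hgap1 _ hj
        rw [sub_add_cancel, hp] at this
        exact ⟨p - 1, by push_cast at *; linarith⟩
  choose P hP using hP
  have hP0 : P 0 = 0 := by
    have := hP 0
    rw [h0] at this
    simpa [hδ0] using this.symm
  have hstep : ∀ j, (u j = u (-1) → P (j + 1) - P j = 1) ∧ (u j ≠ u (-1) → P (j + 1) - P j = 0) := by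
    intro j
    have h1 := hP j
    have h2 := hP (j + 1)
    constructor
    · intro hj
      have h3 := hgap1 j hj
      have : ((P (j + 1) - P j - 1 : ℤ) : ℝ) * δ = 0 := by push_cast at *; linarith
      have := (mul_eq_zero.mp this).resolve_right hδ0
      have : P (j + 1) - P j - 1 = 0 := by exact_mod_cast this
      omega
    · intro hj
      have h3 := hgap0 j ((htwo j).resolve_right hj)
      have : ((P (j + 1) - P j : ℤ) : ℝ) * δ = 0 := by push_cast at *; linarith
      have := (mul_eq_zero.mp this).resolve_right hδ0
      exact_mod_cast this
  obtain ⟨α, hα⟩ := hbal.exists_slope hstep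
  have hcoord : ∀ j, t j = ((j - P j * (r + 1) : ℤ) : ℝ) + P j * β := by
    intro j; rw [hP j, hδ]; push_cast; ring
  have hmul : ∀ j, ∃ i, t i = -β * t j := by
    intro j
    have : -β * t j ∈ Set.range t := hrange ▸ neg_mul_mem_negBetaIntegers h (hmem j)
    exact this
  -- `β² = (-β)² · 1` is a point of `ℤ_{-β}`, hence an integer combination of `1` and `β`.
  obtain ⟨A, B, hq⟩ : ∃ A B : ℤ, β ^ 2 = A * β + B := by
    obtain ⟨i, hi⟩ := hmul 1
    obtain ⟨j, hj⟩ := hmul i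
    refine ⟨P j, j - P j * (r + 1), ?_⟩
    rw [hi, ht1, hcoord j] at hj
    linarith
  have hirr := irrational_of_quadratic hint hq
  have hcoe : ∀ {a c a' c' : ℤ}, (a + c * β : ℝ) = a' + c' * β → a = a' ∧ c = c' := by
    intro a c a' c' e
    have := int_combination_eq_zero hirr (a := a - a') (c := c - c') (by push_cast; linarith)
    omega
  set β' := A - β with hβ'
  set κ := r + 1 - β' with hκ
  have hneβ : β ≠ β' := by
    intro e
    have := int_combination_eq_zero hirr (a := -A) (c := 2) (by push_cast; linarith)
    omega
  have hconj : ∀ j : ℤ, (((j - P j * (r + 1) : ℤ) : ℝ) + P j * β') = j - κ * P j := by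
    intro j; rw [hκ]; push_cast; ring
  have hmul' : ∀ j : ℤ, ∃ i : ℤ, (i + P i * δ : ℝ) = -β * (j + P j * δ) ∧
      (i - κ * P i : ℝ) = -β' * (j - κ * P j) := by
    intro j
    obtain ⟨i, hi⟩ := hmul j
    refine ⟨i, by rw [← hP, ← hP, hi], ?_⟩
    rw [hcoord, hcoord] at hi
    have := hcoe (a := i - P i * (r + 1)) (c := P i) (a' := -(P j * B))
      (c' := -(j - P j * (r + 1)) - P j * A)
      (by rw [hi]; push_cast; linear_combination -(P j : ℝ) * hq)
    rw [← hconj, ← hconj, this.1, this.2]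
    push_cast
    rw [hβ']
    linear_combination (P j : ℝ) * hq
  have hbound := conjugate_bound h hneβ hP0 hα hmul' ⟨1, by rw [← hP, ht1]; exact one_ne_zero⟩
  -- The powers `(-β')^k` are conjugates of the points `(-β)^k` and so are bounded; `β' = ±1` would
  -- make `β` an integer.
  have hβ'1 : |β'| < 1 := by
    have hpow : ∀ k : ℕ, ∃ j : ℤ, (j - κ * P j : ℝ) = (-β') ^ k := by
      intro k
      induction k with
      | zero =>
        refine ⟨1, ?_⟩
        have : P 1 = 0 := by
          have := (hstep 0).2 hne
          simpa [hP0] using this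
        simp [this]
      | succ k ih =>
        obtain ⟨j, hj⟩ := ih
        obtain ⟨i, -, hi⟩ := hmul' j
        exact ⟨i, by rw [hi, hj]; ring⟩
    have hle : |β'| ≤ 1 := by
      by_contra hlt
      push Not at hlt
      obtain ⟨k, hk⟩ := pow_unbounded_of_one_lt |κ| hlt
      obtain ⟨j, hj⟩ := hpow k
      have := hbound j 0
      rw [hj, hP0] at this
      simp only [Int.cast_zero, mul_zero, sub_zero, abs_pow, abs_neg] at this
      linarith
    refine lt_of_le_of_ne hle fun e => ?_
    rcases eq_or_eq_neg_of_abs_eq e with e | e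
    · exact hint (A - 1) (by push_cast; linarith)
    · exact hint (A + 1) (by push_cast; linarith)
  obtain ⟨hb1, hb2⟩ := abs_lt.mp hβ'1
  have hr1' : (1 : ℝ) ≤ r := by exact_mod_cast hr1
  have hb : ∀ a c : ℤ, (a + c * β : ℝ) ∈ negBetaIntegers β → ∀ a' c' : ℤ,
      (a' + c' * β : ℝ) ∈ negBetaIntegers β →
      (a + c * β' : ℝ) - (a' + c' * β') ≤ r + 1 - β' := by
    intro a c hac a' c' hac'
    rw [← hrange] at hac hac'
    obtain ⟨i, hi⟩ := hac
    obtain ⟨j, hj⟩ := hac'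
    rw [hcoord] at hi hj
    obtain ⟨rfl, rfl⟩ := hcoe hi
    obtain ⟨rfl, rfl⟩ := hcoe hj
    rw [hconj, hconj]
    have := hbound i j
    rw [abs_of_pos (by linarith : 0 < κ)] at this
    exact (le_abs_self _).trans this
  refine isQuadraticPisotUnit_of_quadratic h hirr hq ?_ hβ'1
  rcases lt_trichotomy β' 0 with hlt | heq | hgt
  · exact Or.inl (int_unit_of_conjugate_neg h hq hlt hb1 hr hb)
  · exact absurd (by linarith) (hint A)
  · exact Or.inr (int_unit_of_conjugate_pos h hirr hq hgt hr1 hr hr' hb)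

end NegBeta
end

theorem corollaryp (β : ℝ) (hβ : NegBeta.IsItoSadahiro β) :
    (∀ {A : Type*} (u : ℤ → A), NegBeta.IsCodingWord β u →
      (NegBeta.IsSturmian u ↔ NegBeta.IsQuadraticPisotUnit β)) ∧
    (NegBeta.IsQuadraticPisotUnit β → ∃ u : ℤ → Fin 2, NegBeta.IsCodingWord β u) :=
  ⟨fun u hu => ⟨fun hs => NegBeta.isQuadraticPisotUnit_of_sturmian hβ.1 hu hs,
    fun hq => (hq.sturmian hβ.1).2 u hu⟩, fun hq => (NegBeta.IsQuadraticPisotUnit.sturmian.{0} hβ.1 hq).1⟩
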